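/- Let $N\in\mathbb N$, $p>1$, $p'=p/(p-1)$, $s\in(0,1)$ with $N>ps$, $c_0>0$, let $\Omega\subset\mathbb R^N$ be a bounded open set, fix a horizon $\delta>0$ and put $\Omega_\delta=\Omega\cup\bigcup_{y\in\partial\Omega}B(y,\delta)$. Let $k$ be a nonnegative radial kernel on $\mathbb R^N$ that vanishes outside $B(0,\delta)$, is integrable with $$\frac1{C_N}\int_{B(0,\delta)}k(|z|)\,dz=1,\qquad C_N=\frac1{\sigma^{N-1}(S^{N-1})}\int_{S^{N-1}}|\omega\cdot e|^p\,d\sigma^{N-1}(\omega)\quad(|e|=1),$$ where $\sigma^{N-1}$ is the $(N-1)$-dimensional Hausdorff measure, and satisfies $k(|z|)\ge c_0|z|^{-(N+(s-1)p)}$ for $0<|z|<\delta$. For a function $h$ on $\Omega_\delta$ put $$B_h(u,v)=\int_{\Omega_\delta}\int_{\Omega_\delta}\frac{h(x')+h(x)}2\,k(|x'-x|)\,\frac{|u(x')-u(x)|^{p-2}(u(x')-u(x))}{|x'-x|^p}\,(v(x')-v(x))\,dx'\,dx,$$ and let $B=B_1$, $X=\{u\in L^p(\Omega_\delta):B(u,u)<\infty\}$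 and $X_0=\{u\in X:u=0\text{ a.e. in }\Omega_\delta\setminus\Omega\}$. Let $0<h_{\min}<h_{\max}$ and let $h,h_0$ be measurable functions on $\Omega_\delta$ with values in $[h_{\min},h_{\max}]$ a.e. in $\Omega$ and equal to $0$ a.e. in $\Omega_\delta\setminus\Omega$. Let $u_0$ be the restriction to $\Omega_\delta\setminus\Omega$ of some function of $X$. Let $\beta>0$, $\gamma\ge0$, and let $G:\Omega\times\mathbb R\to[0,\infty)$ be measurable and such that, for some constant $L$, $|G(x,a)-G(x,b)|\le L|a-b|$ for all $x\in\Omega$ and $a,b\in\mathbb R$. Let $\mathcal A^\delta$ be the set of pairs $(g,u)\in L^{p'}(\Omega)\times X$ such that $u$ solves the nonlocal $p$-Laplacian problem with source $g$: $$B_h(u,w)=\int_\Omega g\,w\,dx\ \text{ for all }w\in X_0,\qquad u=u_0\ \text{ a.e. in }\Omega_\delta\setminus\Omega,$$ and let $$I_\delta(g,u)=\int_\Omega\bigl(G(x,u(x))+\beta|g(x)|^{p'}\bigr)\,dx+\gamma B_{h_0}(u,u)\in[0,\infty].$$ Then the nonlocal optimal control problem has a solution: there is a pair $(g,u)\in\mathcal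 A^\delta$ (in particular, $\mathcal A^\delta\neq\emptyset$) with $I_\delta(g,u)\le I_\delta(f,v)$ for all $(f,v)\in\mathcal A^\delta$. -/

import Mathlib

open MeasureTheory Set

noncomputable section

namespace NonlocalControl

/-- The constant `C_N`: the mean of `|ω ⬝ e| ^ p` over the unit sphere of `ℝ^N` with respect to
the `(N-1)`-dimensional Hausdorff measure. Its value is the same for all unit vectors `e`. -/
def sphereMean (N : ℕ) (p : ℝ) (e : EuclideanSpace ℝ (Fin N)) : ℝ :=
  1 / (Measure.hausdorffMeasure ((N : ℝ) - 1) : Measure (EuclideanSpace ℝ (Fin N))).real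
      (Metric.sphere 0 1) *
    ∫ ω in Metric.sphere (0 : EuclideanSpace ℝ (Fin N)) 1,
      |inner ℝ ω e| ^ p ∂(Measure.hausdorffMeasure ((N : ℝ) - 1))

/-- Admissible radial kernels with horizon `δ`: `k r` is the value at all points `z` with
`‖z‖ = r`. The kernel is nonnegative, vanishes off the open ball `B(0, δ)`, is integrable with
`(1 / C_N) ∫_{B(0, δ)} k(|z|) dz = 1`, and satisfies `k(|z|) ≥ c₀ / |z| ^ (N + (s - 1) p)` for
`0 < |z| < δ`. -/
structure IsKernel (N : ℕ) (p s c₀ δ : ℝ) (k : ℝ → ℝ) : Prop where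
  nonneg : ∀ r, 0 ≤ r → 0 ≤ k r
  eq_zero : ∀ r, δ ≤ r → k r = 0
  integrable : IntegrableOn (fun z : EuclideanSpace ℝ (Fin N) => k ‖z‖) (Metric.ball 0 δ)
  normalized : ∀ e : EuclideanSpace ℝ (Fin N), ‖e‖ = 1 →
    1 / sphereMean N p e *
      ∫ z in Metric.ball (0 : EuclideanSpace ℝ (Fin N)) δ, k ‖z‖ = 1
  lower_bound : ∀ r, 0 < r → r < δ → c₀ / r ^ ((N : ℝ) + (s - 1) * p) ≤ k r

variable {N : ℕ}

/-- `Ω_δ = Ω ∪ ⋃_{y ∈ ∂Ω} B(y, δ)`. -/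
def extendedDomain (Ω : Set (EuclideanSpace ℝ (Fin N))) (δ : ℝ) :
    Set (EuclideanSpace ℝ (Fin N)) :=
  Ω ∪ ⋃ y ∈ frontier Ω, Metric.ball y δ

/-- The integrand of `B(u, v)`, as a function of the pair `(x', x)`. -/
def integrand (p : ℝ) (k : ℝ → ℝ) (u v : EuclideanSpace ℝ (Fin N) → ℝ)
    (z : EuclideanSpace ℝ (Fin N) × EuclideanSpace ℝ (Fin N)) : ℝ :=
  k ‖z.1 - z.2‖ * (|u z.1 - u z.2| ^ (p - 2) * (u z.1 - u z.2) / ‖z.1 - z.2‖ ^ p) *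
    (v z.1 - v z.2)

/-- `B_h(u, v)`, the double integral over `Ω_δ × Ω_δ` with weight
`H(x', x) = (h(x') + h(x)) / 2`. -/
def weightedForm (Ω : Set (EuclideanSpace ℝ (Fin N))) (δ p : ℝ) (k : ℝ → ℝ)
    (h u v : EuclideanSpace ℝ (Fin N) → ℝ) : ℝ :=
  ∫ z in extendedDomain Ω δ ×ˢ extendedDomain Ω δ,
    (h z.1 + h z.2) / 2 * integrand p k u v z

/-- `u ∈ X`: `u ∈ L^p(Ω_δ)` and `B(u, u) < ∞`. The integrand of `B(u, u)` is nonnegative, so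
finiteness of the integral is integrability. -/
def MemX (Ω : Set (EuclideanSpace ℝ (Fin N))) (δ p : ℝ) (k : ℝ → ℝ)
    (u : EuclideanSpace ℝ (Fin N) → ℝ) : Prop :=
  MemLp u (ENNReal.ofReal p) (volume.restrict (extendedDomain Ω δ)) ∧
    IntegrableOn (integrand p k u u) (extendedDomain Ω δ ×ˢ extendedDomain Ω δ)

/-- `u = v` in `Ω_δ \ Ω`, almost everywhere. -/
def EqOutside (Ω : Set (EuclideanSpace ℝ (Fin N))) (δ : ℝ)
    (u v : EuclideanSpace ℝ (Fin N) → ℝ) : Prop :=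
  ∀ᵐ x ∂(volume.restrict (extendedDomain Ω δ \ Ω)), u x = v x

/-- `w ∈ X₀`: `w ∈ X` and `w = 0` in `Ω_δ \ Ω`. -/
def MemX₀ (Ω : Set (EuclideanSpace ℝ (Fin N))) (δ p : ℝ) (k : ℝ → ℝ)
    (w : EuclideanSpace ℝ (Fin N) → ℝ) : Prop :=
  MemX Ω δ p k w ∧ EqOutside Ω δ w 0

/-- The class `𝓗` of diffusion coefficients. -/
def MemH (Ω : Set (EuclideanSpace ℝ (Fin N))) (δ hmin hmax : ℝ)
    (h : EuclideanSpace ℝ (Fin N) → ℝ) : Prop :=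
  AEMeasurable h (volume.restrict (extendedDomain Ω δ)) ∧
    (∀ᵐ x ∂(volume.restrict Ω), h x ∈ Icc hmin hmax) ∧ EqOutside Ω δ h 0

/-- `u` solves the nonlocal boundary problem with source `g`, coefficient `h` and datum `u₀`. -/
def IsState (Ω : Set (EuclideanSpace ℝ (Fin N))) (δ p : ℝ) (k : ℝ → ℝ)
    (h u₀ g u : EuclideanSpace ℝ (Fin N) → ℝ) : Prop :=
  MemX Ω δ p k u ∧ EqOutside Ω δ u u₀ ∧
    ∀ w, MemX₀ Ω δ p k w → weightedForm Ω δ p k h u w = ∫ x in Ω, g x * w x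

/-- The admissible set `𝓐^δ`: pairs `(g, u)` with `g ∈ L^{p'}(Ω)`, `p' = p / (p - 1)`, and
`u` a state for the source `g`. -/
def Admissible (Ω : Set (EuclideanSpace ℝ (Fin N))) (δ p : ℝ) (k : ℝ → ℝ)
    (h u₀ g u : EuclideanSpace ℝ (Fin N) → ℝ) : Prop :=
  MemLp g (ENNReal.ofReal (p / (p - 1))) (volume.restrict Ω) ∧ IsState Ω δ p k h u₀ g u

/-- The cost `I_δ(g, u) = ∫_Ω (G(x, u(x)) + β |g(x)| ^ p') dx + γ B_{h₀}(u, u)` of an admissible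
pair, with values in `[0, ∞]`; all terms are nonnegative. -/
def cost (Ω : Set (EuclideanSpace ℝ (Fin N))) (δ p : ℝ) (k : ℝ → ℝ)
    (G : EuclideanSpace ℝ (Fin N) → ℝ → ℝ) (β γ : ℝ)
    (h₀ g u : EuclideanSpace ℝ (Fin N) → ℝ) : ENNReal :=
  (∫⁻ x in Ω, ENNReal.ofReal (G x (u x) + β * |g x| ^ (p / (p - 1)))) +
    ENNReal.ofReal (γ * weightedForm Ω δ p k h₀ u u)

end NonlocalControl

end

/-! The proof is the direct method. With respect to `formMeasure`, the form `B_h(u, v)` is the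
integral of `signedPow p` of the increment `u z.1 - u z.2` times the increment of `v`, so all
questions about it become questions about `L^p` functions of pairs.

Admissible pairs exist because an energy minimizer solves the problem with zero source
(`exists_isState_zero`). Along a minimizing sequence, `β > 0` bounds the sources in `L^{p'}`.
Testing the equation with `u - b`, where `b ∈ X` extends the datum, and using the Poincaré
inequality (`exists_poincare`) then bounds the energies (`exists_energy_bound`). The lower bound on
the kernel makes short translations small in `L^p`, and a Kolmogorov–Riesz argument with ball
averages gives precompactness in `L^p` of energy-bounded sequences in `X₀`
(`exists_subseq_tendsto_memX₀`).

The limit in the state equation needs no monotonicity argument: the increments are bounded in `L^p`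
and converge almost everywhere, so the nonlinear term converges against each fixed test increment
(`tendsto_integral_signedPow_mul`), while the sources have a weak limit (`exists_weak_limit`). In
the cost, the `G` term is continuous because `G` is Lipschitz and the states converge in `L^p` on a
bounded set. The other two terms are lower semicontinuous, the source term by the choice of the weak
limit and the energy by Fatou. -/

open Filter Topology

namespace NonlocalControl

/-! ### Elementary inequalities for powers of absolute values. -/

/-- The nonlinearity `a ↦ |a| ^ (p - 2) a` of the `p`-Laplacian. -/
noncomputable def signedPow (p a : ℝ) : ℝ := |a| ^ (p - 2) * a

lemma abs_signedPow {p : ℝ} (hp : 1 < p) (a : ℝ) : |signedPow p a| = |a| ^ (p - 1) := by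
  rcases eq_or_ne a 0 with rfl | ha
  · simp [signedPow, Real.zero_rpow (by linarith : p - 1 ≠ 0)]
  · have h := abs_pos.2 ha
    rw [signedPow, abs_mul, abs_of_nonneg (by positivity), show p - 1 = (p - 2) + 1 by ring,
      Real.rpow_add h, Real.rpow_one]

lemma signedPow_mul_self {p : ℝ} (hp : 1 < p) (a : ℝ) : signedPow p a * a = |a| ^ p := by
  rcases eq_or_ne a 0 with rfl | ha
  · simp [signedPow, Real.zero_rpow (by linarith : p ≠ 0)]
  · have h := abs_pos.2 ha
    rw [signedPow, mul_assoc, ← abs_mul_abs_self a, ← mul_assoc]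
    conv_rhs => rw [show p = (p - 2) + 1 + 1 by ring, Real.rpow_add h, Real.rpow_add h,
      Real.rpow_one]

lemma continuous_signedPow {p : ℝ} (hp : 1 < p) : Continuous (signedPow p) := by
  rw [continuous_iff_continuousAt]
  intro a
  rcases eq_or_ne a 0 with rfl | ha
  · have h0 : signedPow p 0 = 0 := by simp [signedPow]
    rw [ContinuousAt, h0]
    refine squeeze_zero_norm (a := fun t => |t| ^ (p - 1)) (fun t => ?_) ?_
    · rw [Real.norm_eq_abs, abs_signedPow hp]
    · have : Continuous fun t : ℝ => |t| ^ (p - 1) :=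
        continuous_abs.rpow_const fun t => Or.inr (by linarith)
      simpa [Real.zero_rpow (by linarith : p - 1 ≠ 0)] using this.tendsto 0
  · exact (continuous_abs.continuousAt.rpow_const (Or.inl (abs_pos.2 ha).ne')).mul continuousAt_id

/-- Young's inequality with a small parameter, up to the constant: according to whether `b ≤ ε * a`
or not, one of the two terms on the right suffices. -/
lemma rpow_sub_one_mul_le {p : ℝ} (hp : 1 < p) {ε : ℝ} (hε : 0 < ε) {a b : ℝ} (ha : 0 ≤ a)
    (hb : 0 ≤ b) : a ^ (p - 1) * b ≤ ε * a ^ p + (ε⁻¹) ^ (p - 1) * b ^ p := by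
  have key : ∀ t : ℝ, 0 ≤ t → t ^ (p - 1) * t = t ^ p := by
    intro t ht
    rw [← Real.rpow_add_one' ht (by linarith)]; congr 1; ring
  have h1 : 0 ≤ a ^ (p - 1) := Real.rpow_nonneg ha _
  rcases le_total b (ε * a) with h | h
  · have : a ^ (p - 1) * b ≤ ε * a ^ p := by
      rw [← key a ha]; nlinarith [mul_le_mul_of_nonneg_left h h1]
    have : 0 ≤ (ε⁻¹) ^ (p - 1) * b ^ p := by positivity
    linarith
  · have h2 : a ≤ ε⁻¹ * b := by
      rw [inv_mul_eq_div, le_div_iff₀ hε]; linarith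
    have h3 : a ^ (p - 1) ≤ (ε⁻¹ * b) ^ (p - 1) := Real.rpow_le_rpow ha h2 (by linarith)
    rw [Real.mul_rpow (by positivity) hb] at h3
    have : a ^ (p - 1) * b ≤ (ε⁻¹) ^ (p - 1) * b ^ p := by
      rw [← key b hb, ← mul_assoc]; exact mul_le_mul_of_nonneg_right h3 hb
    have : 0 ≤ ε * a ^ p := by positivity
    linarith

/-- The graph of the convex function `|·| ^ p` lies above its tangent at `a`. Young's inequality for
`|b|` and `|a| ^ (p - 1)` gives this without differentiating. -/
lemma abs_rpow_add_signedPow_le {p : ℝ} (hp : 1 < p) (a b : ℝ) :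
    |a| ^ p + p * (signedPow p a * (b - a)) ≤ |b| ^ p := by
  have hy := Real.young_inequality_of_nonneg (a := |b|) (b := |a| ^ (p - 1)) (abs_nonneg b)
    (by positivity) (Real.HolderConjugate.conjExponent hp)
  rw [← Real.rpow_mul (abs_nonneg a), Real.conjExponent,
    show (p - 1) * (p / (p - 1)) = p by field_simp [(by linarith : p - 1 ≠ 0)]] at hy
  have h1 : signedPow p a * b ≤ |b| * |a| ^ (p - 1) := by
    rw [← abs_signedPow hp, mul_comm |b|, ← abs_mul]; exact le_abs_self _
  have h2 := h1.trans hy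
  have h3 : p * (|b| ^ p / p + |a| ^ p / (p / (p - 1))) = |b| ^ p + (p - 1) * |a| ^ p := by
    have : p - 1 ≠ 0 := by linarith
    have : p ≠ 0 := by linarith
    field_simp
  have h4 := mul_le_mul_of_nonneg_left h2 (by linarith : 0 ≤ p)
  rw [h3] at h4
  rw [mul_sub, signedPow_mul_self hp]
  linarith

lemma abs_add_rpow_le {p : ℝ} (hp : 1 < p) (a b : ℝ) :
    |a + b| ^ p ≤ 2 ^ (p - 1) * (|a| ^ p + |b| ^ p) := by
  refine (Real.rpow_le_rpow (abs_nonneg _) (abs_add_le a b) (by linarith)).trans ?_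
  have h := NNReal.rpow_add_le_mul_rpow_add_rpow ⟨|a|, abs_nonneg a⟩ ⟨|b|, abs_nonneg b⟩ hp.le
  exact_mod_cast h

lemma abs_midpoint_rpow_le {q : ℝ} (hq : 1 < q) (a b : ℝ) :
    |(a + b) / 2| ^ q ≤ (|a| ^ q + |b| ^ q) / 2 := by
  have h := abs_add_rpow_le hq a b
  rw [abs_div, abs_two, Real.div_rpow (abs_nonneg _) zero_le_two, div_le_iff₀ (by positivity)]
  have h2 : (2 : ℝ) ^ q = 2 ^ (q - 1) * 2 := by
    rw [← Real.rpow_add_one two_ne_zero]; congr 1; ring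
  rw [h2]; linarith

lemma abs_midpoint_rpow_lt {q : ℝ} (hq : 1 < q) {a b : ℝ} (hab : a ≠ b) :
    |(a + b) / 2| ^ q < (|a| ^ q + |b| ^ q) / 2 := by
  have hq0 : 0 < q := by linarith
  by_cases h : |a| = |b|
  · have hb : a = -b := (abs_eq_abs.1 h).resolve_left hab
    have hb0 : b ≠ 0 := by rintro rfl; simp at hb; exact hab hb
    have : 0 < |b| := abs_pos.2 hb0
    subst hb
    simp only [neg_add_cancel, zero_div, abs_zero, Real.zero_rpow hq0.ne']
    positivity
  · have h1 := (strictConvexOn_rpow hq).2 (abs_nonneg a) (abs_nonneg b) h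
      (by norm_num : (0 : ℝ) < 1 / 2) (by norm_num : (0 : ℝ) < 1 / 2) (by norm_num)
    simp only [smul_eq_mul] at h1
    have h2 : |(a + b) / 2| ^ q ≤ (1 / 2 * |a| + 1 / 2 * |b|) ^ q := by
      refine Real.rpow_le_rpow (abs_nonneg _) ?_ hq0.le
      rw [abs_div, abs_two]; linarith [abs_add_le a b]
    linarith

/-- Uniform convexity of `|a| ^ q`. -/
lemma exists_abs_sub_rpow_le {q : ℝ} (hq : 1 < q) {ε : ℝ} (hε : 0 < ε) :
    ∃ C : ℝ, 0 ≤ C ∧ ∀ a b : ℝ, |a - b| ^ q ≤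
      ε * (|a| ^ q + |b| ^ q) + C * ((|a| ^ q + |b| ^ q) / 2 - |(a + b) / 2| ^ q) := by
  have hq0 : 0 < q := by linarith
  have hcont : ∀ f : ℝ × ℝ → ℝ, Continuous f → Continuous fun z => |f z| ^ q :=
    fun f hf => hf.abs.rpow_const fun _ => Or.inr hq0.le
  have hc1 := hcont _ continuous_fst
  have hc2 := hcont _ continuous_snd
  have hc3 := hcont (fun z => z.1 - z.2) (by fun_prop)
  have hc4 := hcont (fun z => (z.1 + z.2) / 2) (by fun_prop)
  -- By homogeneity it is enough to treat unit vectors of the sup norm. Off `K` the `ε` term alone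
  -- suffices; on the compact set `K` one has `a ≠ b`, so the midpoint deficit has a positive
  -- minimum `m`.
  set K : Set (ℝ × ℝ) := Metric.sphere 0 1 ∩ {z | ε * (|z.1| ^ q + |z.2| ^ q) ≤ |z.1 - z.2| ^ q}
  have hK : IsCompact K :=
    (isCompact_sphere _ _).inter_right (isClosed_le (continuous_const.mul (hc1.add hc2)) hc3)
  obtain ⟨m, hm, hmK⟩ : ∃ m : ℝ, 0 < m ∧
      ∀ z ∈ K, m ≤ (|z.1| ^ q + |z.2| ^ q) / 2 - |(z.1 + z.2) / 2| ^ q := by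
    refine hK.exists_forall_le' (a := 0)
      ((((hc1.add hc2).div_const 2).sub hc4).continuousOn) fun z hz => ?_
    refine sub_pos.2 (abs_midpoint_rpow_lt hq fun h => ?_)
    have h1 : ε * (|z.1| ^ q + |z.2| ^ q) ≤ |z.1 - z.2| ^ q := hz.2
    rw [h, sub_self, abs_zero, Real.zero_rpow hq0.ne'] at h1
    have h2 : ‖z‖ = 1 := by simpa using hz.1
    rw [Prod.norm_def, h, max_self, Real.norm_eq_abs] at h2
    rw [h2, Real.one_rpow] at h1
    linarith
  have hunit : ∀ a b : ℝ, ‖(a, b)‖ = 1 → |a - b| ^ q ≤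
      ε * (|a| ^ q + |b| ^ q) + 2 ^ q / m * ((|a| ^ q + |b| ^ q) / 2 - |(a + b) / 2| ^ q) := by
    intro a b h
    rcases le_total (|a - b| ^ q) (ε * (|a| ^ q + |b| ^ q)) with h1 | h1
    · have := abs_midpoint_rpow_le hq a b
      have : 0 ≤ 2 ^ q / m * ((|a| ^ q + |b| ^ q) / 2 - |(a + b) / 2| ^ q) :=
        mul_nonneg (by positivity) (by linarith)
      linarith
    · have h2 := hmK (a, b) ⟨by simpa using h, h1⟩
      have ha : |a| ≤ 1 := h ▸ norm_fst_le (a, b)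
      have hb : |b| ≤ 1 := h ▸ norm_snd_le (a, b)
      have h3 : |a - b| ^ q ≤ 2 ^ q :=
        Real.rpow_le_rpow (abs_nonneg _) (by linarith [abs_sub a b]) hq0.le
      have h4 : 2 ^ q ≤ 2 ^ q / m * ((|a| ^ q + |b| ^ q) / 2 - |(a + b) / 2| ^ q) := by
        rw [div_mul_eq_mul_div, le_div_iff₀ hm]
        exact mul_le_mul_of_nonneg_left h2 (by positivity)
      have : 0 ≤ ε * (|a| ^ q + |b| ^ q) := by positivity
      linarith
  -- On the unit sphere `|a - b| ≤ 2`, and on `K` the deficit is at least `m`; hence the constant.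
  refine ⟨2 ^ q / m, by positivity, fun a b => ?_⟩
  rcases eq_or_ne (a, b) 0 with h | h
  · obtain ⟨rfl, rfl⟩ : a = 0 ∧ b = 0 := by simpa using h
    simp [Real.zero_rpow hq0.ne']
  · set r := ‖(a, b)‖
    have hr : 0 < r := norm_pos_iff.2 h
    have key := hunit (r⁻¹ * a) (r⁻¹ * b) (by
      have : (r⁻¹ * a, r⁻¹ * b) = r⁻¹ • (a, b) := by simp
      rw [this, norm_smul, norm_inv, Real.norm_of_nonneg hr.le, inv_mul_cancel₀ hr.ne'])
    have hs : ∀ t : ℝ, |r⁻¹ * t| ^ q = (r⁻¹) ^ q * |t| ^ q := fun t => by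
      rw [abs_mul, abs_of_pos (inv_pos.2 hr), Real.mul_rpow (by positivity) (abs_nonneg _)]
    rw [← mul_sub, show (r⁻¹ * a + r⁻¹ * b) / 2 = r⁻¹ * ((a + b) / 2) by ring, hs, hs, hs, hs] at key
    have hr' : 0 < (r⁻¹) ^ q := by positivity
    refine le_of_mul_le_mul_left (key.trans (le_of_eq ?_)) hr'
    ring

/-! ### Weak cluster points in uniformly convex spaces. -/

/-- In a uniformly convex Banach space, a sequence with convergent norms has a "weak cluster point"
whose norm is at most the limit of the norms: the limit of almost norm-minimal convex combinations
of the tails. -/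
lemma exists_limit_of_convex_combinations {E : Type*} [NormedAddCommGroup E] [NormedSpace ℝ E]
    [CompleteSpace E] {q : ℝ} (hq : 1 < q)
    (hE : ∀ ε : ℝ, 0 < ε → ∃ C : ℝ, 0 ≤ C ∧ ∀ a b : E, ‖a - b‖ ^ q ≤
      ε * (‖a‖ ^ q + ‖b‖ ^ q) +
        C * ((‖a‖ ^ q + ‖b‖ ^ q) / 2 - ‖(1 / 2 : ℝ) • a + (1 / 2 : ℝ) • b‖ ^ q))
    (x : ℕ → E) (l : ℝ) (hx : Tendsto (fun j => ‖x j‖ ^ q) atTop (𝓝 l)) :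
    ∃ y : E, ‖y‖ ^ q ≤ l ∧ ∀ (T : E →L[ℝ] ℝ) (c : ℝ),
      Tendsto (fun j => T (x j)) atTop (𝓝 c) → T y = c := by
  have hq0 : 0 < q := by linarith
  set S : ℕ → Set E := fun n => convexHull ℝ (x '' Ici n)
  have hxS : ∀ n j, n ≤ j → x j ∈ S n := fun n j h => subset_convexHull ℝ _ ⟨j, h, rfl⟩
  have hS : ∀ n m, n ≤ m → S m ⊆ S n := fun n m h =>
    convexHull_mono (image_mono (Ici_subset_Ici.2 h))
  set d : ℕ → ℝ := fun n => sInf ((fun y => ‖y‖ ^ q) '' S n)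
  have hbdd : ∀ n, BddBelow ((fun y => ‖y‖ ^ q) '' S n) := fun n =>
    ⟨0, by rintro _ ⟨y, -, rfl⟩; positivity⟩
  have hne : ∀ n, ((fun y => ‖y‖ ^ q) '' S n).Nonempty := fun n => ⟨_, x n, hxS n n le_rfl, rfl⟩
  have hd : ∀ n y, y ∈ S n → d n ≤ ‖y‖ ^ q := fun n y hy => csInf_le (hbdd n) ⟨y, hy, rfl⟩
  have hd0 : ∀ n, 0 ≤ d n := fun n =>
    le_csInf (hne n) (by rintro _ ⟨y, -, rfl⟩; positivity)
  have hmono : Monotone d := fun n m h =>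
    csInf_le_csInf (hbdd n) (hne m) (image_mono (hS n m h))
  have hdl : ∀ n, d n ≤ l := fun n =>
    ge_of_tendsto hx (eventually_atTop.2 ⟨n, fun j hj => hd n _ (hxS n j hj)⟩)
  have hlim : Tendsto d atTop (𝓝 (⨆ n, d n)) :=
    tendsto_atTop_ciSup hmono ⟨l, by rintro _ ⟨n, rfl⟩; exact hdl n⟩
  set D := ⨆ n, d n
  have hD0 : 0 ≤ D := ge_of_tendsto' hlim hd0
  have hDl : D ≤ l := le_of_tendsto' hlim hdl
  have hex : ∀ n : ℕ, ∃ y ∈ S n, ‖y‖ ^ q < d n + 1 / ((n : ℝ) + 1) := by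
    intro n
    obtain ⟨_, ⟨y, hy, rfl⟩, h⟩ := exists_lt_of_csInf_lt (hne n)
      (lt_add_of_pos_right (d n) (by positivity : 0 < 1 / ((n : ℝ) + 1)))
    exact ⟨y, hy, h⟩
  choose y hyS hy using hex
  have hyD : Tendsto (fun n => ‖y n‖ ^ q) atTop (𝓝 D) := by
    refine tendsto_of_tendsto_of_tendsto_of_le_of_le hlim
      (by simpa using hlim.add tendsto_one_div_add_atTop_nhds_zero_nat)
      (fun n => hd n _ (hyS n)) fun n => (hy n).le
  -- The midpoint of `y n` and `y n₀` is still in `S n₀`, so its `q`-th power exceeds `D - τ`, while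
  -- both ends are below `D + τ`. The deficit is thus less than `2 * τ`; `η` and `τ` make the two
  -- terms of `hE` at most `ε ^ q / 2` and `ε ^ q / 4`.
  have hcauchy : CauchySeq y := by
    rw [Metric.cauchySeq_iff']
    intro ε hε
    have hεq : 0 < ε ^ q := by positivity
    set η := ε ^ q / (4 * (D + 1))
    have hη : 0 < η := by positivity
    obtain ⟨C, hC0, hC⟩ := hE η hη
    set τ := min 1 (ε ^ q / (8 * (C + 1)))
    have hτ : 0 < τ := lt_min one_pos (by positivity)
    obtain ⟨n₀, hn₀⟩ := eventually_atTop.1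
      ((hyD.eventually_lt_const (lt_add_of_pos_right D hτ)).and
        (hlim.eventually_const_lt (sub_lt_self D hτ)))
    refine ⟨n₀, fun n hn => ?_⟩
    have h1 := hC (y n) (y n₀)
    have h2 : d n₀ ≤ ‖(1 / 2 : ℝ) • y n + (1 / 2 : ℝ) • y n₀‖ ^ q :=
      hd _ _ (convex_convexHull ℝ _ (hS _ _ hn (hyS n)) (hyS n₀) (by norm_num) (by norm_num)
        (by norm_num))
    have h3 := (hn₀ n hn).1
    have h4 := (hn₀ n₀ le_rfl).1
    have h5 := (hn₀ n₀ le_rfl).2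
    have h6 : η * (‖y n‖ ^ q + ‖y n₀‖ ^ q) ≤ ε ^ q / 2 := by
      calc _ ≤ η * (2 * (D + 1)) := by
            refine mul_le_mul_of_nonneg_left ?_ hη.le
            have : τ ≤ 1 := min_le_left _ _
            linarith
        _ = ε ^ q / 2 := by
            have : D + 1 ≠ 0 := by positivity
            simp only [η]; field_simp; norm_num
    have h7 : C * ((‖y n‖ ^ q + ‖y n₀‖ ^ q) / 2 - ‖(1 / 2 : ℝ) • y n + (1 / 2 : ℝ) • y n₀‖ ^ q) ≤
        ε ^ q / 4 := by
      calc _ ≤ C * (2 * τ) := mul_le_mul_of_nonneg_left (by linarith) hC0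
        _ ≤ (C + 1) * (2 * (ε ^ q / (8 * (C + 1)))) := by
            gcongr
            · linarith
            · exact min_le_right _ _
        _ = ε ^ q / 4 := by field_simp; norm_num
    have h8 : ‖y n - y n₀‖ ^ q < ε ^ q := by linarith
    rw [dist_eq_norm]
    exact (Real.rpow_lt_rpow_iff (norm_nonneg _) hε.le hq0).1 h8
  obtain ⟨z, hz⟩ := cauchySeq_tendsto_of_complete hcauchy
  refine ⟨z, ?_, fun T c hT => ?_⟩
  · have : Tendsto (fun n => ‖y n‖ ^ q) atTop (𝓝 (‖z‖ ^ q)) :=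
      (hz.norm).rpow_const (Or.inr hq0.le)
    rw [tendsto_nhds_unique this hyD]
    exact hDl
  · refine tendsto_nhds_unique ((T.continuous.tendsto z).comp hz) ?_
    rw [Metric.tendsto_atTop] at hT ⊢
    intro ε hε
    obtain ⟨n₀, hn₀⟩ := hT ε hε
    refine ⟨n₀, fun n hn => ?_⟩
    -- A half-way house between strong and weak convergence: once the tail of `T (x j)` lies in a
    -- ball, so does `T` of every convex combination of that tail.
    have hconv : Convex ℝ (T ⁻¹' Metric.ball c ε) :=
      (convex_ball c ε).linear_preimage (T : E →ₗ[ℝ] ℝ)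
    have : S n ⊆ T ⁻¹' Metric.ball c ε := convexHull_min (by
      rintro _ ⟨j, hj, rfl⟩
      exact hn₀ j (le_trans hn hj)) hconv
    exact this (hyS n)

/-! ### Integral estimates and limits in `L^p`. -/

section LpSpaces

variable {α : Type*} {mα : MeasurableSpace α} {μ : Measure α} {p : ℝ}

lemma memLp_iff_integrable_abs_rpow (hp : 1 < p) {U : α → ℝ} (hU : AEStronglyMeasurable U μ) :
    MemLp U (ENNReal.ofReal p) μ ↔ Integrable (fun z => |U z| ^ p) μ := by
  have h := integrable_norm_rpow_iff (p := ENNReal.ofReal p) hU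
    (by simpa using (by linarith : 0 < p)) ENNReal.ofReal_ne_top
  rw [ENNReal.toReal_ofReal (by linarith)] at h
  exact h.symm

lemma integrable_abs_rpow (hp : 1 < p) {U : α → ℝ} (hU : MemLp U (ENNReal.ofReal p) μ) :
    Integrable (fun z => |U z| ^ p) μ :=
  (memLp_iff_integrable_abs_rpow hp hU.1).1 hU

lemma norm_toLp_rpow (hp : 1 < p) {U : α → ℝ} (hU : MemLp U (ENNReal.ofReal p) μ) :
    ‖hU.toLp U‖ ^ p = ∫ z, |U z| ^ p ∂μ := by
  rw [Lp.norm_toLp, hU.eLpNorm_eq_integral_rpow_norm (by simpa using (by linarith : 0 < p))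
    ENNReal.ofReal_ne_top, ENNReal.toReal_ofReal (by positivity),
    ENNReal.toReal_ofReal (by linarith), ← Real.rpow_mul (by positivity),
    inv_mul_cancel₀ (by linarith), Real.rpow_one]
  rfl

lemma integrable_signedPow_mul (hp : 1 < p) {U W : α → ℝ} (hU : MemLp U (ENNReal.ofReal p) μ)
    (hW : MemLp W (ENNReal.ofReal p) μ) : Integrable (fun z => signedPow p (U z) * W z) μ := by
  refine ((integrable_abs_rpow hp hU).add (integrable_abs_rpow hp hW)).mono'
    (((continuous_signedPow hp).comp_aestronglyMeasurable hU.1).mul hW.1)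
    (Eventually.of_forall fun z => ?_)
  rw [Real.norm_eq_abs, abs_mul, abs_signedPow hp]
  simpa using rpow_sub_one_mul_le hp one_pos (abs_nonneg (U z)) (abs_nonneg (W z))

lemma integral_abs_rpow_add_signedPow_le (hp : 1 < p) {U V : α → ℝ}
    (hU : MemLp U (ENNReal.ofReal p) μ) (hV : MemLp V (ENNReal.ofReal p) μ) :
    ∫ z, |U z| ^ p ∂μ + p * ∫ z, signedPow p (U z) * (V z - U z) ∂μ ≤ ∫ z, |V z| ^ p ∂μ := by
  have h1 := integrable_abs_rpow hp hU
  have h2 : Integrable (fun z => p * (signedPow p (U z) * (V z - U z))) μ :=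
    (integrable_signedPow_mul hp hU (hV.sub hU)).const_mul p
  rw [← integral_const_mul, ← integral_add h1 h2]
  exact integral_mono (h1.add h2) (integrable_abs_rpow hp hV)
    fun z => abs_rpow_add_signedPow_le hp (U z) (V z)

/-- Boundedness in `L^p` together with convergence almost everywhere lets one pass to the limit in
the nonlinear term, tested against a fixed function of `L^p`. -/
lemma tendsto_integral_signedPow_mul (hp : 1 < p) {U : ℕ → α → ℝ} {V W : α → ℝ} {M : ℝ}
    (hU : ∀ j, MemLp (U j) (ENNReal.ofReal p) μ) (hV : MemLp V (ENNReal.ofReal p) μ)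
    (hW : MemLp W (ENNReal.ofReal p) μ) (hM : ∀ j, ∫ z, |U j z| ^ p ∂μ ≤ M)
    (hlim : ∀ᵐ z ∂μ, Tendsto (fun j => U j z) atTop (𝓝 (V z))) :
    Tendsto (fun j => ∫ z, signedPow p (U j z) * W z ∂μ) atTop
      (𝓝 (∫ z, signedPow p (V z) * W z ∂μ)) := by
  have hp0 : 0 < p := by linarith
  set F : ℕ → α → ℝ := fun j z => signedPow p (U j z) * W z
  set F₀ : α → ℝ := fun z => signedPow p (V z) * W z
  have hF : ∀ j, Integrable (F j) μ := fun j => integrable_signedPow_mul hp (hU j) hW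
  have hF₀ : Integrable F₀ μ := integrable_signedPow_mul hp hV hW
  have hM0 : 0 ≤ M := le_trans (integral_nonneg fun z => by positivity) (hM 0)
  rw [Metric.tendsto_atTop']
  intro ε hε
  -- With this value `η * ∫ |U j| ^ p` is at most `ε / 2`.
  set η := ε / (2 * (M + 1))
  have hη : 0 < η := by positivity
  have hUp : ∀ j, Integrable (fun z => |U j z| ^ p) μ := fun j => integrable_abs_rpow hp (hU j)
  -- By Young, `|F j| ≤ η |U j| ^ p + C_η |W| ^ p`. After subtracting `η |U j| ^ p`, the positive
  -- part is dominated by a fixed integrable function and tends to zero almost everywhere.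
  have hR : Tendsto (fun j => ∫ z, max (|F j z - F₀ z| - η * |U j z| ^ p) 0 ∂μ) atTop (𝓝 0) := by
    suffices h : Tendsto (fun j => ∫ z, max (|F j z - F₀ z| - η * |U j z| ^ p) 0 ∂μ) atTop
        (𝓝 (∫ z, (0 : ℝ) ∂μ)) by rwa [integral_zero] at h
    refine tendsto_integral_of_dominated_convergence
      (fun z => (η⁻¹) ^ (p - 1) * |W z| ^ p + |F₀ z|) (fun j => ?_)
      (((integrable_abs_rpow hp hW).const_mul _).add hF₀.abs)
      (fun j => Eventually.of_forall fun z => ?_) ?_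
    · exact ((((hF j).sub hF₀).abs.sub ((hUp j).const_mul η)).sup (integrable_zero _ _ _)).1
    · rw [Real.norm_of_nonneg (le_max_right _ _)]
      refine max_le ?_ (by positivity)
      have h1 := rpow_sub_one_mul_le hp hη (abs_nonneg (U j z)) (abs_nonneg (W z))
      rw [← abs_signedPow hp, ← abs_mul] at h1
      have := abs_sub (F j z) (F₀ z)
      simp only [F, F₀] at *
      linarith
    · filter_upwards [hlim] with z hz
      have h1 : Tendsto (fun j => F j z) atTop (𝓝 (F₀ z)) :=
        (((continuous_signedPow hp).tendsto _).comp hz).mul_const _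
      have h2 : Tendsto (fun j => |U j z| ^ p) atTop (𝓝 (|V z| ^ p)) :=
        hz.abs.rpow_const (Or.inr hp0.le)
      have h3 := (((h1.sub_const (F₀ z)).abs.sub (h2.const_mul η)).max
        (tendsto_const_nhds (x := (0 : ℝ))))
      have h4 : 0 ≤ η * |V z| ^ p := by positivity
      rwa [sub_self, abs_zero, zero_sub, max_eq_right (by linarith)] at h3
  obtain ⟨n₀, hn₀⟩ := eventually_atTop.1 (hR.eventually_lt_const (half_pos hε))
  refine ⟨n₀, fun j hj => ?_⟩
  have hmax : Integrable (fun z => max (|F j z - F₀ z| - η * |U j z| ^ p) 0) μ :=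
    (((hF j).sub hF₀).abs.sub ((hUp j).const_mul η)).sup (integrable_zero _ _ _)
  rw [Real.dist_eq, ← integral_sub (hF j) hF₀]
  calc |∫ z, F j z - F₀ z ∂μ| ≤ ∫ z, |F j z - F₀ z| ∂μ := abs_integral_le_integral_abs
    _ ≤ ∫ z, max (|F j z - F₀ z| - η * |U j z| ^ p) 0 + η * |U j z| ^ p ∂μ := by
        refine integral_mono ((hF j).sub hF₀).abs (hmax.add ((hUp j).const_mul η)) fun z => ?_
        have := le_max_left (|F j z - F₀ z| - η * |U j z| ^ p) 0
        simp only
        linarith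
    _ = ∫ z, max (|F j z - F₀ z| - η * |U j z| ^ p) 0 ∂μ + η * ∫ z, |U j z| ^ p ∂μ := by
        rw [integral_add hmax ((hUp j).const_mul η), integral_const_mul]
    _ < ε / 2 + ε / 2 := by
        refine add_lt_add_of_lt_of_le (hn₀ j hj.le) ?_
        calc η * ∫ z, |U j z| ^ p ∂μ ≤ η * (M + 1) :=
              mul_le_mul_of_nonneg_left (by linarith [hM j]) hη.le
          _ = ε / 2 := by
            have : M + 1 ≠ 0 := by positivity
            simp only [η]; field_simp
    _ = ε := by ring

lemma Lp_uniformConvex {q : ℝ} (hq : 1 < q) [Fact (1 ≤ ENNReal.ofReal q)] (ε : ℝ) (hε : 0 < ε) :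
    ∃ C : ℝ, 0 ≤ C ∧ ∀ a b : Lp ℝ (ENNReal.ofReal q) μ, ‖a - b‖ ^ q ≤
      ε * (‖a‖ ^ q + ‖b‖ ^ q) +
        C * ((‖a‖ ^ q + ‖b‖ ^ q) / 2 - ‖(1 / 2 : ℝ) • a + (1 / 2 : ℝ) • b‖ ^ q) := by
  obtain ⟨C, hC, h⟩ := exists_abs_sub_rpow_le hq hε
  have hn : ∀ x : Lp ℝ (ENNReal.ofReal q) μ, ‖x‖ ^ q = ∫ z, |x z| ^ q ∂μ := fun x => by
    rw [← norm_toLp_rpow hq (Lp.memLp x), Lp.toLp_coeFn]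
  refine ⟨C, hC, fun a b => ?_⟩
  have hi : ∀ x : Lp ℝ (ENNReal.ofReal q) μ, Integrable (fun z => |x z| ^ q) μ :=
    fun x => integrable_abs_rpow hq (Lp.memLp x)
  have hs : Integrable (fun z => |a z| ^ q + |b z| ^ q) μ := (hi a).add (hi b)
  have hm := hi ((1 / 2 : ℝ) • a + (1 / 2 : ℝ) • b)
  have hd : Integrable (fun z => (|a z| ^ q + |b z| ^ q) / 2 -
      |((1 / 2 : ℝ) • a + (1 / 2 : ℝ) • b : Lp ℝ (ENNReal.ofReal q) μ) z| ^ q) μ :=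
    (hs.div_const 2).sub hm
  simp only [hn]
  rw [← integral_add (hi a) (hi b), ← integral_div, ← integral_sub (hs.div_const 2) hm,
    ← integral_const_mul, ← integral_const_mul, ← integral_add (hs.const_mul _) (hd.const_mul _)]
  refine integral_mono_ae (hi _) ((hs.const_mul _).add (hd.const_mul _)) ?_
  filter_upwards [Lp.coeFn_sub a b, Lp.coeFn_add ((1 / 2 : ℝ) • a) ((1 / 2 : ℝ) • b),
    Lp.coeFn_smul (1 / 2 : ℝ) a, Lp.coeFn_smul (1 / 2 : ℝ) b] with z h1 h2 h3 h4
  have h5 : (1 / 2 : ℝ) • a z + (1 / 2 : ℝ) • b z = (a z + b z) / 2 := by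
    simp only [smul_eq_mul]; ring
  simp only [h1, h2, h3, h4, Pi.sub_apply, Pi.add_apply, Pi.smul_apply, h5]
  exact h (a z) (b z)

/-- A substitute for weak compactness of balls of `L^q`. -/
lemma exists_weak_limit {q q' : ℝ} (hqq : q.HolderConjugate q') (g : ℕ → α → ℝ)
    (hg : ∀ j, MemLp (g j) (ENNReal.ofReal q) μ) (l : ℝ)
    (hl : Tendsto (fun j => ∫ x, |g j x| ^ q ∂μ) atTop (𝓝 l)) :
    ∃ G : α → ℝ, MemLp G (ENNReal.ofReal q) μ ∧ ∫ x, |G x| ^ q ∂μ ≤ l ∧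
      ∀ f : α → ℝ, MemLp f (ENNReal.ofReal q') μ → ∀ c : ℝ,
        Tendsto (fun j => ∫ x, g j x * f x ∂μ) atTop (𝓝 c) → ∫ x, G x * f x ∂μ = c := by
  have hq := hqq.lt
  have : Fact (1 ≤ ENNReal.ofReal q) := ⟨by simpa using hq.le⟩
  have : Fact (1 ≤ ENNReal.ofReal q') := ⟨by simpa using hqq.symm.lt.le⟩
  have : ENNReal.HolderConjugate (ENNReal.ofReal q) (ENNReal.ofReal q') := hqq.ennrealOfReal
  obtain ⟨y, hy, hT⟩ := exists_limit_of_convex_combinations hq (Lp_uniformConvex (μ := μ) hq)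
    (fun j => (hg j).toLp (g j)) l (by simpa only [norm_toLp_rpow hq] using hl)
  refine ⟨y, Lp.memLp y, ?_, fun f hf c hc => ?_⟩
  · rwa [← norm_toLp_rpow hq (Lp.memLp y), Lp.toLp_coeFn]
  · have key : ∀ x : Lp ℝ (ENNReal.ofReal q) μ,
        ((ContinuousLinearMap.mul ℝ ℝ).lpPairing μ (ENNReal.ofReal q) (ENNReal.ofReal q')).flip
          (hf.toLp f) x = ∫ z, x z * f z ∂μ := by
      intro x
      rw [ContinuousLinearMap.flip_apply, ContinuousLinearMap.lpPairing_eq_integral]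
      refine integral_congr_ae ?_
      filter_upwards [hf.coeFn_toLp] with z hz
      simp [hz]
    rw [← key]
    refine hT _ c (hc.congr fun j => ?_)
    rw [key]
    refine integral_congr_ae ?_
    filter_upwards [(hg j).coeFn_toLp] with z hz
    rw [hz]

lemma enorm_rpow_eq_ofReal (hp : 1 < p) (t : ℝ) : ‖t‖ₑ ^ p = ENNReal.ofReal (|t| ^ p) := by
  rw [Real.enorm_eq_ofReal_abs, ENNReal.ofReal_rpow_of_nonneg (abs_nonneg t) (by linarith)]

lemma rpow_eLpNorm (hp : 1 < p) (f : α → ℝ) :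
    eLpNorm f (ENNReal.ofReal p) μ ^ p = ∫⁻ x, ‖f x‖ₑ ^ p ∂μ := by
  have hp0 : 0 < p := by linarith
  rw [eLpNorm_eq_lintegral_rpow_enorm_toReal (by simpa using hp0) ENNReal.ofReal_ne_top,
    ENNReal.toReal_ofReal hp0.le, ← ENNReal.rpow_mul, one_div_mul_cancel hp0.ne', ENNReal.rpow_one]

/-- Jensen's inequality, through monotonicity of `L^p` norms in the exponent on a probability space.
-/
lemma enorm_integral_rpow_le [IsProbabilityMeasure μ] (hp : 1 < p) {f : α → ℝ}
    (hf : AEStronglyMeasurable f μ) : ‖∫ x, f x ∂μ‖ₑ ^ p ≤ ∫⁻ x, ‖f x‖ₑ ^ p ∂μ := by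
  rw [← rpow_eLpNorm hp]
  refine ENNReal.rpow_le_rpow ?_ (by linarith)
  refine (enorm_integral_le_lintegral_enorm f).trans ?_
  rw [← eLpNorm_one_eq_lintegral_enorm]
  exact eLpNorm_le_eLpNorm_of_exponent_le (by simpa using hp.le) hf

lemma lintegral_enorm_rpow_eq (hp : 1 < p) {f : α → ℝ} (hf : MemLp f (ENNReal.ofReal p) μ) :
    ∫⁻ x, ‖f x‖ₑ ^ p ∂μ = ENNReal.ofReal (∫ x, |f x| ^ p ∂μ) := by
  rw [ofReal_integral_eq_lintegral_ofReal (integrable_abs_rpow hp hf)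
    (Eventually.of_forall fun x => by simp only [Pi.zero_apply]; positivity)]
  simp only [enorm_rpow_eq_ofReal hp]

/-- Fatou's lemma for `L^p` norms. -/
lemma memLp_and_integral_le_of_tendsto_ae (hp : 1 < p) {U : ℕ → α → ℝ} {V : α → ℝ}
    (hU : ∀ j, MemLp (U j) (ENNReal.ofReal p) μ)
    (hlim : ∀ᵐ z ∂μ, Tendsto (fun j => U j z) atTop (𝓝 (V z))) {M : ℝ}
    (hM : ∀ᶠ j in atTop, ∫ z, |U j z| ^ p ∂μ ≤ M) :
    MemLp V (ENNReal.ofReal p) μ ∧ ∫ z, |V z| ^ p ∂μ ≤ M := by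
  have hp0 : 0 < p := by linarith
  have hV : AEStronglyMeasurable V μ := aestronglyMeasurable_of_tendsto_ae atTop
    (fun j => (hU j).1) hlim
  obtain ⟨j₀, hj₀⟩ := hM.exists
  have hM0 : 0 ≤ M := le_trans (integral_nonneg fun z => by positivity) hj₀
  have h1 : ∫⁻ z, ‖V z‖ₑ ^ p ∂μ ≤ ENNReal.ofReal M := by
    calc ∫⁻ z, ‖V z‖ₑ ^ p ∂μ = ∫⁻ z, liminf (fun j => ‖U j z‖ₑ ^ p) atTop ∂μ := by
          refine lintegral_congr_ae ?_
          filter_upwards [hlim] with z hz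
          exact ((ENNReal.continuous_rpow_const.tendsto _).comp hz.enorm).liminf_eq.symm
      _ ≤ liminf (fun j => ∫⁻ z, ‖U j z‖ₑ ^ p ∂μ) atTop :=
          lintegral_liminf_le' fun j => (hU j).1.enorm.pow_const p
      _ ≤ ENNReal.ofReal M := by
          refine liminf_le_of_frequently_le' (Eventually.frequently ?_)
          filter_upwards [hM] with j hj
          rw [lintegral_enorm_rpow_eq hp (hU j)]
          exact ENNReal.ofReal_le_ofReal hj
  have hmem : MemLp V (ENNReal.ofReal p) μ := by
    refine ⟨hV, ?_⟩
    rw [← ENNReal.rpow_lt_top_iff_of_pos hp0, rpow_eLpNorm hp]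
    exact h1.trans_lt ENNReal.ofReal_lt_top
  refine ⟨hmem, ?_⟩
  rwa [lintegral_enorm_rpow_eq hp hmem, ENNReal.ofReal_le_ofReal_iff hM0] at h1

lemma integral_le_of_tendsto_ae (hp : 1 < p) {U : ℕ → α → ℝ} {V : α → ℝ}
    (hU : ∀ j, MemLp (U j) (ENNReal.ofReal p) μ)
    (hlim : ∀ᵐ z ∂μ, Tendsto (fun j => U j z) atTop (𝓝 (V z))) {l : ℝ}
    (hl : Tendsto (fun j => ∫ z, |U j z| ^ p ∂μ) atTop (𝓝 l)) :
    ∫ z, |V z| ^ p ∂μ ≤ l :=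
  le_of_forall_pos_le_add fun _ hε => (memLp_and_integral_le_of_tendsto_ae hp hU hlim
    (hl.eventually_le_const (lt_add_of_pos_right l hε))).2

lemma integral_abs_add_rpow_le (hp : 1 < p) {U V : α → ℝ} (hU : MemLp U (ENNReal.ofReal p) μ)
    (hV : MemLp V (ENNReal.ofReal p) μ) :
    ∫ z, |U z + V z| ^ p ∂μ ≤ 2 ^ (p - 1) * (∫ z, |U z| ^ p ∂μ + ∫ z, |V z| ^ p ∂μ) := by
  have h1 := integrable_abs_rpow hp hU
  have h2 := integrable_abs_rpow hp hV
  rw [← integral_add h1 h2, ← integral_const_mul]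
  exact integral_mono (integrable_abs_rpow hp (hU.add hV)) ((h1.add h2).const_mul _)
    fun z => abs_add_rpow_le hp _ _

/-- The Euler-Lagrange equation for the `p`-th power of the `L^p` norm. -/
lemma integral_signedPow_mul_eq_zero (hp : 1 < p) {U W : α → ℝ}
    (hU : MemLp U (ENNReal.ofReal p) μ) (hW : MemLp W (ENNReal.ofReal p) μ)
    (hmin : ∀ t : ℝ, ∫ z, |U z| ^ p ∂μ ≤ ∫ z, |U z + t * W z| ^ p ∂μ) :
    ∫ z, signedPow p (U z) * W z ∂μ = 0 := by
  -- One-sided version. The tangent inequality at `U + t W`, compared with the value at `U`, and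
  -- minimality give `∫ signedPow p (U + t W) * W ≥ 0` for each `t > 0`; then `t → 0`. Equality
  -- follows by applying this to `-W`.
  have key : ∀ W : α → ℝ, MemLp W (ENNReal.ofReal p) μ →
      (∀ t : ℝ, ∫ z, |U z| ^ p ∂μ ≤ ∫ z, |U z + t * W z| ^ p ∂μ) →
      0 ≤ ∫ z, signedPow p (U z) * W z ∂μ := by
    intro W hW hmin
    set t : ℕ → ℝ := fun n => 1 / ((n : ℝ) + 1)
    have ht0 : ∀ n, 0 < t n := fun n => by positivity
    have ht1 : ∀ n, t n ≤ 1 := fun n => by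
      rw [div_le_one (by positivity)]; linarith [(Nat.cast_nonneg n : (0 : ℝ) ≤ n)]
    have htl : Tendsto t atTop (𝓝 0) := tendsto_one_div_add_atTop_nhds_zero_nat
    have hm : ∀ n, MemLp (fun z => U z + t n * W z) (ENNReal.ofReal p) μ := fun n =>
      hU.add (hW.const_mul (t n))
    have hlim := tendsto_integral_signedPow_mul (μ := μ) hp (U := fun n z => U z + t n * W z)
      (V := U) (W := W) (M := 2 ^ (p - 1) * (∫ z, |U z| ^ p ∂μ + ∫ z, |W z| ^ p ∂μ)) hm hU hW
      (fun n => by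
        refine (integral_abs_add_rpow_le hp hU (hW.const_mul (t n))).trans ?_
        gcongr
        · exact integrable_abs_rpow hp (hW.const_mul (t n))
        · exact integrable_abs_rpow hp hW
        · intro z
          refine Real.rpow_le_rpow (abs_nonneg _) ?_ (by linarith)
          rw [abs_mul, abs_of_pos (ht0 n)]
          exact mul_le_of_le_one_left (abs_nonneg _) (ht1 n))
      (Eventually.of_forall fun z => by
        have := (htl.mul_const (W z)).const_add (U z)
        simpa using this)
    refine ge_of_tendsto' hlim fun n => ?_
    have h1 := integral_abs_rpow_add_signedPow_le hp (hm n) hU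
    have h2 : ∫ z, signedPow p (U z + t n * W z) * (U z - (U z + t n * W z)) ∂μ =
        -(t n * ∫ z, signedPow p (U z + t n * W z) * W z ∂μ) := by
      rw [← integral_const_mul, ← integral_neg]
      congr 1
      funext z
      ring
    rw [h2] at h1
    have h3 : 0 ≤ (p * t n) * ∫ z, signedPow p (U z + t n * W z) * W z ∂μ := by
      linarith [hmin (t n)]
    exact nonneg_of_mul_nonneg_right h3 (mul_pos (by linarith) (ht0 n))
  refine le_antisymm ?_ (key W hW hmin)
  have h4 := key (fun z => -W z) hW.neg fun t => by
    refine (hmin (-t)).trans_eq ?_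
    simp
  simp only [mul_neg, integral_neg] at h4
  linarith

/-- The factor of the `w` term becomes small with `η`, which allows it to be absorbed in the energy
bound. -/
lemma integral_mul_le_add (hp : 1 < p) {η : ℝ} (hη : 0 < η) {g w : α → ℝ} (hg : MemLp g (ENNReal.ofReal (p / (p - 1))) μ)
    (hw : MemLp w (ENNReal.ofReal p) μ) :
    ∫ x, g x * w x ∂μ ≤
      η⁻¹ * ∫ x, |g x| ^ (p / (p - 1)) ∂μ + η ^ (p - 1) * ∫ x, |w x| ^ p ∂μ := by
  have hpq : p.HolderConjugate (p / (p - 1)) := Real.HolderConjugate.conjExponent hp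
  have : ENNReal.HolderConjugate (ENNReal.ofReal (p / (p - 1))) (ENNReal.ofReal p) :=
    hpq.symm.ennrealOfReal
  have h1 := (integrable_abs_rpow hpq.symm.lt hg).const_mul η⁻¹
  have h2 := (integrable_abs_rpow hp hw).const_mul (η ^ (p - 1))
  rw [← integral_const_mul, ← integral_const_mul, ← integral_add h1 h2]
  refine integral_mono (hg.integrable_mul hw) (h1.add h2) fun x => ?_
  -- Young with `a = |g x| ^ (1 / (p - 1))`, so that `a ^ (p - 1) = |g x|` and `a ^ p = |g x| ^ p'`.
  have h3 := rpow_sub_one_mul_le hp (inv_pos.2 hη)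
    (Real.rpow_nonneg (abs_nonneg (g x)) (p - 1)⁻¹) (abs_nonneg (w x))
  have hp1 : p - 1 ≠ 0 := by linarith
  rw [← Real.rpow_mul (abs_nonneg _), ← Real.rpow_mul (abs_nonneg _), inv_mul_cancel₀ hp1,
    Real.rpow_one, inv_inv, inv_mul_eq_div (p - 1) p, ← abs_mul] at h3
  exact (le_abs_self _).trans h3

end LpSpaces

/-! ### The extended domain, the form as an integral of increments, and the space `X`. -/

variable {N : ℕ} {Ω : Set (EuclideanSpace ℝ (Fin N))} {p s c₀ δ : ℝ} {k : ℝ → ℝ}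

local notation "E" => EuclideanSpace ℝ (Fin N)

lemma isOpen_extendedDomain (hΩ : IsOpen Ω) (δ : ℝ) : IsOpen (extendedDomain Ω δ) :=
  hΩ.union (isOpen_biUnion fun _ _ => Metric.isOpen_ball)

lemma subset_extendedDomain (Ω : Set E) (δ : ℝ) : Ω ⊆ extendedDomain Ω δ := subset_union_left

/-- For `y` off `Ω`, the distance to `Ω` is attained at a frontier point, which is then closer than
`δ`. -/
lemma mem_extendedDomain_of_dist_lt {x y : E} (hx : x ∈ Ω) (h : dist y x < δ) :
    y ∈ extendedDomain Ω δ := by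
  by_cases hy : y ∈ Ω
  · exact Or.inl hy
  · obtain ⟨z, hz, hyz⟩ := exists_mem_frontier_infDist_compl_eq_dist (s := Ωᶜ) hy
      (fun h => (h ▸ mem_univ x : x ∈ Ωᶜ) hx)
    rw [frontier_compl] at hz
    rw [compl_compl] at hyz
    refine Or.inr (mem_iUnion₂.2 ⟨z, hz, ?_⟩)
    rw [Metric.mem_ball, ← hyz]
    exact (Metric.infDist_le_dist_of_mem hx).trans_lt h

/-- The density of the form `B_h` with respect to Lebesgue measure. -/
noncomputable def formWeight (p : ℝ) (k : ℝ → ℝ) (h : E → ℝ) (z : E × E) : ℝ :=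
  (h z.1 + h z.2) / 2 * (k ‖z.1 - z.2‖ / ‖z.1 - z.2‖ ^ p)

/-- The measure on `Ω_δ × Ω_δ` that turns `B_h` into a `p`-Laplacian form on difference
functions. -/
noncomputable def formMeasure (Ω : Set E) (δ p : ℝ) (k : ℝ → ℝ) (h : E → ℝ) : Measure (E × E) :=
  (volume.restrict (extendedDomain Ω δ ×ˢ extendedDomain Ω δ)).withDensity
    fun z => ENNReal.ofReal (formWeight p k h z)

lemma IsKernel.aemeasurable (hk : IsKernel N p s c₀ δ k) :
    AEMeasurable (fun z : E => k ‖z‖) volume := by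
  have h := (aemeasurable_indicator_iff Metric.isOpen_ball.measurableSet).2
    hk.integrable.aestronglyMeasurable.aemeasurable
  convert h using 1
  funext z
  by_cases hz : z ∈ Metric.ball (0 : E) δ
  · simp [hz]
  · rw [indicator_of_notMem hz]
    exact hk.eq_zero _ (by simpa using hz)

lemma volume_restrict_prod (D : Set E) :
    (volume.restrict (D ×ˢ D) : Measure (E × E)) = (volume.restrict D).prod (volume.restrict D) := by
  rw [Measure.volume_eq_prod, Measure.prod_restrict]

lemma ae_prod_of_ae {D : Set E} {P : E → Prop} (h : ∀ᵐ x ∂volume.restrict D, P x) :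
    ∀ᵐ z ∂(volume.restrict (D ×ˢ D) : Measure (E × E)), P z.1 ∧ P z.2 := by
  rw [volume_restrict_prod]
  exact (Measure.quasiMeasurePreserving_fst.ae h).and (Measure.quasiMeasurePreserving_snd.ae h)

lemma aemeasurable_formWeight (hk : IsKernel N p s c₀ δ k) {D : Set E} {h : E → ℝ}
    (hh : AEMeasurable h (volume.restrict D)) :
    AEMeasurable (formWeight p k h) (volume.restrict (D ×ˢ D)) := by
  have h1 : AEMeasurable (fun z : E × E => k ‖z.1 - z.2‖) (volume.restrict (D ×ˢ D)) := by
    refine AEMeasurable.restrict ?_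
    have := hk.aemeasurable.comp_quasiMeasurePreserving
      (quasiMeasurePreserving_sub_of_right_invariant (volume : Measure E) (volume : Measure E))
    exact this
  have h2 : AEMeasurable (fun z : E × E => ‖z.1 - z.2‖ ^ p) (volume.restrict (D ×ˢ D)) := by
    have : Measurable (fun z : E × E => ‖z.1 - z.2‖ ^ p) := by fun_prop
    exact this.aemeasurable
  have h3 : AEMeasurable (fun z : E × E => (h z.1 + h z.2) / 2) (volume.restrict (D ×ˢ D)) := by
    rw [volume_restrict_prod]
    exact (hh.comp_fst.add hh.comp_snd).div_const 2
  exact h3.mul (h1.div h2)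

lemma formWeight_nonneg (hk : IsKernel N p s c₀ δ k) {D : Set E} {h : E → ℝ}
    (hh : ∀ᵐ x ∂volume.restrict D, 0 ≤ h x) :
    ∀ᵐ z ∂(volume.restrict (D ×ˢ D) : Measure (E × E)), 0 ≤ formWeight p k h z := by
  filter_upwards [ae_prod_of_ae hh] with z hz
  have := hk.nonneg _ (norm_nonneg (z.1 - z.2))
  have h1 := hz.1
  have h2 := hz.2
  unfold formWeight
  positivity

lemma integral_formMeasure (hk : IsKernel N p s c₀ δ k) {h : E → ℝ}
    (hm : AEMeasurable h (volume.restrict (extendedDomain Ω δ)))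
    (hh : ∀ᵐ x ∂volume.restrict (extendedDomain Ω δ), 0 ≤ h x) (f : E × E → ℝ) :
    ∫ z, f z ∂formMeasure Ω δ p k h =
      ∫ z in extendedDomain Ω δ ×ˢ extendedDomain Ω δ, formWeight p k h z * f z := by
  rw [formMeasure, integral_withDensity_eq_integral_toReal_smul₀
    (aemeasurable_formWeight hk hm).ennreal_ofReal (Eventually.of_forall fun _ => by simp)]
  refine integral_congr_ae ?_
  filter_upwards [formWeight_nonneg hk hh] with z hz
  simp [ENNReal.toReal_ofReal hz]

lemma integrable_formMeasure (hk : IsKernel N p s c₀ δ k) {h : E → ℝ}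
    (hm : AEMeasurable h (volume.restrict (extendedDomain Ω δ)))
    (hh : ∀ᵐ x ∂volume.restrict (extendedDomain Ω δ), 0 ≤ h x) (f : E × E → ℝ) :
    Integrable f (formMeasure Ω δ p k h) ↔
      IntegrableOn (fun z => formWeight p k h z * f z)
        (extendedDomain Ω δ ×ˢ extendedDomain Ω δ) := by
  rw [formMeasure, integrable_withDensity_iff_integrable_smul₀'
    (aemeasurable_formWeight hk hm).ennreal_ofReal (Eventually.of_forall fun _ => by simp)]
  refine integrable_congr ?_
  filter_upwards [formWeight_nonneg hk hh] with z hz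
  simp [ENNReal.toReal_ofReal hz]

lemma formWeight_mul_signedPow (h u v : E → ℝ) (z : E × E) :
    formWeight p k h z * (signedPow p (u z.1 - u z.2) * (v z.1 - v z.2)) =
      (h z.1 + h z.2) / 2 * integrand p k u v z := by
  simp only [formWeight, signedPow, integrand]
  ring

lemma weightedForm_eq (hk : IsKernel N p s c₀ δ k) {h : E → ℝ}
    (hm : AEMeasurable h (volume.restrict (extendedDomain Ω δ)))
    (hh : ∀ᵐ x ∂volume.restrict (extendedDomain Ω δ), 0 ≤ h x) (u v : E → ℝ) :
    weightedForm Ω δ p k h u v =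
      ∫ z, signedPow p (u z.1 - u z.2) * (v z.1 - v z.2) ∂formMeasure Ω δ p k h := by
  rw [integral_formMeasure hk hm hh]
  simp only [formWeight_mul_signedPow, weightedForm]

/-- `B_h(u, u)`, in the form `∫ |u(x') - u(x)| ^ p`. -/
noncomputable def energy (Ω : Set E) (δ p : ℝ) (k : ℝ → ℝ) (h u : E → ℝ) : ℝ :=
  ∫ z, |u z.1 - u z.2| ^ p ∂formMeasure Ω δ p k h

lemma weightedForm_self (hp : 1 < p) (hk : IsKernel N p s c₀ δ k) {h : E → ℝ}
    (hm : AEMeasurable h (volume.restrict (extendedDomain Ω δ)))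
    (hh : ∀ᵐ x ∂volume.restrict (extendedDomain Ω δ), 0 ≤ h x) (u : E → ℝ) :
    weightedForm Ω δ p k h u u = energy Ω δ p k h u := by
  simp only [weightedForm_eq hk hm hh, signedPow_mul_self hp, energy]

lemma formMeasure_absolutelyContinuous (h : E → ℝ) :
    formMeasure Ω δ p k h ≪ volume.restrict (extendedDomain Ω δ ×ˢ extendedDomain Ω δ) :=
  withDensity_absolutelyContinuous _ _

lemma ae_formMeasure_of_ae {h : E → ℝ} {P : E → Prop}
    (hP : ∀ᵐ x ∂volume.restrict (extendedDomain Ω δ), P x) :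
    ∀ᵐ z ∂formMeasure Ω δ p k h, P z.1 ∧ P z.2 :=
  (formMeasure_absolutelyContinuous h).ae_le (ae_prod_of_ae hP)

lemma aestronglyMeasurable_increment {h u : E → ℝ}
    (hu : AEStronglyMeasurable u (volume.restrict (extendedDomain Ω δ))) :
    AEStronglyMeasurable (fun z : E × E => u z.1 - u z.2) (formMeasure Ω δ p k h) := by
  refine AEStronglyMeasurable.mono_ac (formMeasure_absolutelyContinuous h) ?_
  rw [volume_restrict_prod]
  exact hu.comp_fst.sub hu.comp_snd

lemma integrand_self_eq (hp : 1 < p) (u : E → ℝ) (z : E × E) :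
    integrand p k u u z = formWeight p k (fun _ => 1) z * |u z.1 - u z.2| ^ p := by
  rw [← signedPow_mul_self hp, formWeight_mul_signedPow]
  ring

/-- Both conditions become `L^p` memberships, linear in `u`; the vector space properties of `X`
follow. -/
lemma memX_iff (hp : 1 < p) (hk : IsKernel N p s c₀ δ k) {u : E → ℝ} :
    MemX Ω δ p k u ↔ MemLp u (ENNReal.ofReal p) (volume.restrict (extendedDomain Ω δ)) ∧
      MemLp (fun z : E × E => u z.1 - u z.2) (ENNReal.ofReal p)
        (formMeasure Ω δ p k fun _ => 1) := by
  refine and_congr_right fun hu => ?_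
  rw [memLp_iff_integrable_abs_rpow hp (aestronglyMeasurable_increment hu.1),
    integrable_formMeasure hk aemeasurable_const (Eventually.of_forall fun _ => zero_le_one)]
  simp only [← integrand_self_eq hp]

lemma MemX.sub (hp : 1 < p) (hk : IsKernel N p s c₀ δ k) {u v : E → ℝ}
    (hu : MemX Ω δ p k u) (hv : MemX Ω δ p k v) : MemX Ω δ p k (fun x => u x - v x) := by
  rw [memX_iff hp hk] at *
  refine ⟨hu.1.sub hv.1, (hu.2.sub hv.2).ae_eq (Eventually.of_forall fun z => ?_)⟩
  simp only [Pi.sub_apply]; ring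

lemma MemX.add (hp : 1 < p) (hk : IsKernel N p s c₀ δ k) {u v : E → ℝ}
    (hu : MemX Ω δ p k u) (hv : MemX Ω δ p k v) : MemX Ω δ p k (fun x => u x + v x) := by
  rw [memX_iff hp hk] at *
  refine ⟨hu.1.add hv.1, (hu.2.add hv.2).ae_eq (Eventually.of_forall fun z => ?_)⟩
  simp only [Pi.add_apply]; ring

lemma MemX.const_mul (hp : 1 < p) (hk : IsKernel N p s c₀ δ k) {u : E → ℝ}
    (hu : MemX Ω δ p k u) (c : ℝ) : MemX Ω δ p k (fun x => c * u x) := by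
  rw [memX_iff hp hk] at *
  refine ⟨hu.1.const_mul c, (hu.2.const_mul c).ae_eq (Eventually.of_forall fun z => ?_)⟩
  simp only; ring

lemma MemX.congr (hp : 1 < p) (hk : IsKernel N p s c₀ δ k) {u v : E → ℝ}
    (hu : MemX Ω δ p k u) (huv : u =ᵐ[volume.restrict (extendedDomain Ω δ)] v) :
    MemX Ω δ p k v := by
  rw [memX_iff hp hk] at *
  refine ⟨hu.1.ae_eq huv, hu.2.ae_eq ?_⟩
  filter_upwards [ae_formMeasure_of_ae huv] with z hz
  rw [hz.1, hz.2]

lemma energy_congr {h u v : E → ℝ} (huv : u =ᵐ[volume.restrict (extendedDomain Ω δ)] v) :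
    energy Ω δ p k h u = energy Ω δ p k h v := by
  refine integral_congr_ae ?_
  filter_upwards [ae_formMeasure_of_ae huv] with z hz
  rw [hz.1, hz.2]

lemma ae_extendedDomain_of_ae {P : E → Prop} (hΩ : IsOpen Ω)
    (h1 : ∀ᵐ x ∂volume.restrict Ω, P x)
    (h2 : ∀ᵐ x ∂volume.restrict (extendedDomain Ω δ \ Ω), P x) :
    ∀ᵐ x ∂volume.restrict (extendedDomain Ω δ), P x := by
  rw [ae_restrict_iff' hΩ.measurableSet] at h1
  rw [ae_restrict_iff' ((isOpen_extendedDomain hΩ δ).measurableSet.diff hΩ.measurableSet)] at h2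
  rw [ae_restrict_iff' (isOpen_extendedDomain hΩ δ).measurableSet]
  filter_upwards [h1, h2] with x hx1 hx2 hx
  by_cases h : x ∈ Ω
  · exact hx1 h
  · exact hx2 ⟨hx, h⟩

/-- Elements of `X₀` may thus be replaced by functions vanishing everywhere off `Ω`, which can be
translated in the whole space. -/
lemma ae_eq_indicator_of_eqOutside (hΩ : IsOpen Ω) {w : E → ℝ} (hw : EqOutside Ω δ w 0) :
    w =ᵐ[volume.restrict (extendedDomain Ω δ)] Ω.indicator w := by
  refine ae_extendedDomain_of_ae hΩ ?_ ?_
  · filter_upwards [ae_restrict_mem hΩ.measurableSet] with x hx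
    rw [indicator_of_mem hx]
  · filter_upwards [hw, ae_restrict_mem
      ((isOpen_extendedDomain hΩ δ).measurableSet.diff hΩ.measurableSet)] with x hx hxm
    rw [indicator_of_notMem hxm.2, hx]
    rfl

/-! ### Comparison of the energies for different coefficients. -/

variable {hmin hmax : ℝ} {h h₀ u₀ : EuclideanSpace ℝ (Fin N) → ℝ}

lemma MemH.nonneg (hΩ : IsOpen Ω) (hmin_pos : 0 < hmin) (hh : MemH Ω δ hmin hmax h) :
    ∀ᵐ x ∂volume.restrict (extendedDomain Ω δ), 0 ≤ h x :=
  ae_extendedDomain_of_ae hΩ (hh.2.1.mono fun _ hx => hmin_pos.le.trans hx.1)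
    (hh.2.2.mono fun _ hx => hx.ge)

lemma MemH.le (hΩ : IsOpen Ω) (hmin_pos : 0 < hmin) (hlt : hmin < hmax)
    (hh : MemH Ω δ hmin hmax h) :
    ∀ᵐ x ∂volume.restrict (extendedDomain Ω δ), h x ≤ hmax :=
  ae_extendedDomain_of_ae hΩ (hh.2.1.mono fun _ hx => hx.2)
    (hh.2.2.mono fun _ hx => hx.le.trans (hmin_pos.trans hlt).le)

lemma formMeasure_le (hk : IsKernel N p s c₀ δ k) (hΩ : IsOpen Ω) (hmin_pos : 0 < hmin)
    (hlt : hmin < hmax) (hh : MemH Ω δ hmin hmax h) :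
    formMeasure Ω δ p k h ≤ ENNReal.ofReal hmax • formMeasure Ω δ p k fun _ => 1 := by
  rw [formMeasure, formMeasure, ← withDensity_smul' _ _ ENNReal.ofReal_ne_top]
  refine withDensity_mono ?_
  filter_upwards [ae_prod_of_ae (hh.le hΩ hmin_pos hlt)] with z hz
  have h0 := hmin_pos.trans hlt
  rw [Pi.smul_apply, smul_eq_mul, ← ENNReal.ofReal_mul h0.le]
  refine ENNReal.ofReal_le_ofReal ?_
  have h1 := hz.1
  have h2 := hz.2
  have := hk.nonneg _ (norm_nonneg (z.1 - z.2))
  have h3 : 0 ≤ k ‖z.1 - z.2‖ / ‖z.1 - z.2‖ ^ p := by positivity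
  rw [formWeight, formWeight, ← mul_assoc]
  exact mul_le_mul_of_nonneg_right (by linarith) h3

lemma MemX.memLp_increment (hp : 1 < p) (hk : IsKernel N p s c₀ δ k) (hΩ : IsOpen Ω)
    (hmin_pos : 0 < hmin) (hlt : hmin < hmax) (hh : MemH Ω δ hmin hmax h) {u : E → ℝ}
    (hu : MemX Ω δ p k u) :
    MemLp (fun z : E × E => u z.1 - u z.2) (ENNReal.ofReal p) (formMeasure Ω δ p k h) :=
  ((memX_iff hp hk).1 hu).2.of_measure_le_smul ENNReal.ofReal_ne_top
    (formMeasure_le hk hΩ hmin_pos hlt hh)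

/-- On `X₀` the form with coefficient in `𝓗` controls the form with coefficient `1`. -/
lemma energy_one_le (hp : 1 < p) (hk : IsKernel N p s c₀ δ k) (hΩ : IsOpen Ω)
    (hmin_pos : 0 < hmin) (hlt : hmin < hmax) (hh : MemH Ω δ hmin hmax h) {w : E → ℝ}
    (hw : MemX₀ Ω δ p k w) :
    energy Ω δ p k (fun _ => 1) w ≤ 2 / hmin * energy Ω δ p k h w := by
  have hone : ∀ᵐ x ∂volume.restrict (extendedDomain Ω δ), (0 : ℝ) ≤ (fun _ : E => 1) x :=
    Eventually.of_forall fun _ => zero_le_one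
  have h1 := (integrable_formMeasure hk aemeasurable_const hone _).1
    (integrable_abs_rpow hp ((memX_iff hp hk).1 hw.1).2)
  have h2 := (integrable_formMeasure hk hh.1 (hh.nonneg hΩ hmin_pos) _).1
    (integrable_abs_rpow hp (hw.1.memLp_increment hp hk hΩ hmin_pos hlt hh))
  rw [energy, energy, integral_formMeasure hk aemeasurable_const hone,
    integral_formMeasure hk hh.1 (hh.nonneg hΩ hmin_pos), ← integral_const_mul]
  refine integral_mono_ae h1 (h2.const_mul _) ?_
  -- The coefficient vanishes off `Ω`, but so does `w`. If the increment of `w` is nonzero, one of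
  -- the two points has `h ≥ hmin`, so the average of `h` is at least `hmin / 2`; hence the factor
  -- `2 / hmin`.
  have hdich : ∀ᵐ x ∂volume.restrict (extendedDomain Ω δ), hmin ≤ h x ∨ w x = 0 :=
    ae_extendedDomain_of_ae hΩ (hh.2.1.mono fun _ hx => Or.inl hx.1)
      (hw.2.mono fun _ hx => Or.inr hx)
  filter_upwards [ae_prod_of_ae hdich, ae_prod_of_ae (hh.nonneg hΩ hmin_pos)] with z hz hz0
  have := hk.nonneg _ (norm_nonneg (z.1 - z.2))
  have h3 : 0 ≤ k ‖z.1 - z.2‖ / ‖z.1 - z.2‖ ^ p := by positivity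
  by_cases hzero : w z.1 = 0 ∧ w z.2 = 0
  · rw [hzero.1, hzero.2]
    simp [Real.zero_rpow (by linarith : p ≠ 0)]
  · have h4 : hmin ≤ h z.1 + h z.2 := by
      rcases hz.1 with h | h
      · linarith [hz0.2]
      · rcases hz.2 with h' | h'
        · linarith [hz0.1]
        · exact absurd ⟨h, h'⟩ hzero
    have h5 : (1 + 1 : ℝ) / 2 ≤ 2 / hmin * ((h z.1 + h z.2) / 2) := by
      rw [div_mul_div_comm, le_div_iff₀ (by positivity)]
      linarith
    simp only [formWeight]
    rw [← mul_assoc, ← mul_assoc]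
    exact mul_le_mul_of_nonneg_right (mul_le_mul_of_nonneg_right h5 h3) (by positivity)

lemma ofReal_energy (hp : 1 < p) (hk : IsKernel N p s c₀ δ k) {w : E → ℝ}
    (hw : MemX Ω δ p k w) :
    ENNReal.ofReal (energy Ω δ p k (fun _ => 1) w) =
      ∫⁻ z in extendedDomain Ω δ ×ˢ extendedDomain Ω δ,
        ENNReal.ofReal (formWeight p k (fun _ => 1) z * |w z.1 - w z.2| ^ p) := by
  have hone : ∀ᵐ x ∂volume.restrict (extendedDomain Ω δ), (0 : ℝ) ≤ (fun _ : E => 1) x :=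
    Eventually.of_forall fun _ => zero_le_one
  have h1 := (integrable_formMeasure hk aemeasurable_const hone _).1
    (integrable_abs_rpow hp ((memX_iff hp hk).1 hw).2)
  rw [energy, integral_formMeasure hk aemeasurable_const hone,
    ofReal_integral_eq_lintegral_ofReal h1]
  filter_upwards [formWeight_nonneg hk hone] with z hz
  simp only [Pi.zero_apply]
  positivity

/-! ### Translation estimates and the Poincaré inequality. -/

/-- Dividing the kernel by `‖y - x‖ ^ p` raises the exponent in its lower bound to `N + s p`, so at
distances below `r` the weight is at least `c₀ / r ^ (N + s p)`. -/
lemma abs_sub_rpow_le_formWeight (hp : 1 < p) (hs : 0 < s) (hc₀ : 0 < c₀)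
    (hk : IsKernel N p s c₀ δ k) {r : ℝ} (hr : 0 < r) (hrδ : r ≤ δ) (w : E → ℝ) {x y : E}
    (hxy : ‖y - x‖ < r) :
    |w y - w x| ^ p ≤ r ^ ((N : ℝ) + s * p) / c₀ *
      (formWeight p k (fun _ => 1) (y, x) * |w y - w x| ^ p) := by
  rcases eq_or_ne y x with rfl | hne
  · simp [Real.zero_rpow (by linarith : p ≠ 0)]
  · have hpos : 0 < ‖y - x‖ := norm_pos_iff.2 (sub_ne_zero.2 hne)
    have h1 := hk.lower_bound _ hpos (hxy.trans_le hrδ)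
    have h2 : c₀ / ‖y - x‖ ^ ((N : ℝ) + s * p) ≤ k ‖y - x‖ / ‖y - x‖ ^ p := by
      rw [show (N : ℝ) + s * p = ((N : ℝ) + (s - 1) * p) + p by ring, Real.rpow_add hpos,
        ← div_div]
      gcongr
    have h3 : ‖y - x‖ ^ ((N : ℝ) + s * p) ≤ r ^ ((N : ℝ) + s * p) :=
      Real.rpow_le_rpow hpos.le hxy.le (by positivity)
    have h4 : 1 ≤ r ^ ((N : ℝ) + s * p) / c₀ * formWeight p k (fun _ : E => 1) (y, x) := by
      calc (1 : ℝ) = r ^ ((N : ℝ) + s * p) / c₀ * (c₀ / r ^ ((N : ℝ) + s * p)) := by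
            field_simp
        _ ≤ r ^ ((N : ℝ) + s * p) / c₀ * (k ‖y - x‖ / ‖y - x‖ ^ p) := by
            refine mul_le_mul_of_nonneg_left (le_trans ?_ h2) (by positivity)
            gcongr
        _ = _ := by simp [formWeight]
    rw [← mul_assoc]
    exact le_mul_of_one_le_left (by positivity) h4

/-- Short translations of functions vanishing off `Ω` are controlled by the energy. -/
lemma lintegral_translate_le (hp : 1 < p) (hs : 0 < s) (hc₀ : 0 < c₀)
    (hk : IsKernel N p s c₀ δ k) (hΩ : IsOpen Ω) {w : E → ℝ} (hw : MemX Ω δ p k w)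
    (hw0 : ∀ x ∉ Ω, w x = 0) {r : ℝ} (hr : 0 < r) (hrδ : r ≤ δ) :
    ∫⁻ x, ∫⁻ z in Metric.ball (0 : E) r, ‖w (x + z) - w x‖ₑ ^ p ≤
      ENNReal.ofReal (r ^ ((N : ℝ) + s * p) / c₀) *
        ENNReal.ofReal (energy Ω δ p k (fun _ => 1) w) := by
  set D := extendedDomain Ω δ
  have hD : MeasurableSet D := (isOpen_extendedDomain hΩ δ).measurableSet
  set F : E × E → ENNReal := (D ×ˢ D).indicator
    fun z => ENNReal.ofReal (formWeight p k (fun _ => 1) z * |w z.1 - w z.2| ^ p)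
  have hFm : AEMeasurable F (volume.prod volume) := by
    rw [← Measure.volume_eq_prod]
    refine (aemeasurable_indicator_iff (hD.prod hD)).2 (AEMeasurable.ennreal_ofReal ?_)
    refine (aemeasurable_formWeight hk aemeasurable_const).mul ?_
    have : AEMeasurable (fun z : E × E => w z.1 - w z.2) (volume.restrict (D ×ˢ D)) := by
      rw [volume_restrict_prod]
      exact hw.1.1.aemeasurable.comp_fst.sub hw.1.1.aemeasurable.comp_snd
    exact this.abs.pow_const p
  have hF : ENNReal.ofReal (energy Ω δ p k (fun _ => 1) w) = ∫⁻ x, ∫⁻ y, F (y, x) := by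
    rw [ofReal_energy hp hk hw, ← lintegral_prod_symm F hFm, ← Measure.volume_eq_prod,
      lintegral_indicator (hD.prod hD)]
  rw [hF, ← lintegral_const_mul' _ _ ENNReal.ofReal_ne_top]
  refine lintegral_mono fun x => ?_
  rw [← lintegral_const_mul' _ _ ENNReal.ofReal_ne_top,
    ← lintegral_indicator Metric.isOpen_ball.measurableSet,
    ← lintegral_add_left_eq_self (fun y => _ * F (y, x)) x]
  refine lintegral_mono fun z => ?_
  by_cases hz : z ∈ Metric.ball (0 : E) r
  · rw [indicator_of_mem hz]
    have hz' : ‖x + z - x‖ < r := by simpa using hz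
    have hdist : dist (x + z) x < δ := by rw [dist_eq_norm]; exact hz'.trans_le hrδ
    -- Points within `δ` of `Ω` belong to `D`. A pair not in `D ×ˢ D` therefore has both points off
    -- `Ω`, where `w` vanishes.
    by_cases hmem : (x + z, x) ∈ D ×ˢ D
    · rw [enorm_rpow_eq_ofReal hp]
      simp only [F]
      rw [indicator_of_mem hmem, ← ENNReal.ofReal_mul (by positivity)]
      exact ENNReal.ofReal_le_ofReal (abs_sub_rpow_le_formWeight hp hs hc₀ hk hr hrδ w hz')
    · have h1 : x ∉ Ω := fun hx =>
        hmem ⟨mem_extendedDomain_of_dist_lt hx hdist, subset_extendedDomain Ω δ hx⟩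
      have h2 : x + z ∉ Ω := fun hx =>
        hmem ⟨subset_extendedDomain Ω δ hx, mem_extendedDomain_of_dist_lt hx
          (by rwa [dist_comm])⟩
      rw [hw0 _ h1, hw0 _ h2]
      simp [ENNReal.zero_rpow_of_pos (by linarith : 0 < p)]
  · rw [indicator_of_notMem hz]
    exact zero_le

lemma MemX.memLp_of_zero_off (hΩ : IsOpen Ω) {w : E → ℝ}
    (hw : MemX Ω δ p k w) (hw0 : ∀ x ∉ Ω, w x = 0) : MemLp w (ENNReal.ofReal p) volume := by
  have h := (memLp_indicator_iff_restrict (isOpen_extendedDomain hΩ δ).measurableSet).2 hw.1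
  rwa [indicator_eq_self.2] at h
  intro x hx
  by_contra hxD
  exact hx (hw0 x fun h => hxD (subset_extendedDomain Ω δ h))

/-- The increment over `n • z` telescopes into `n` increments over `z`, all of the same norm by
translation invariance. -/
lemma eLpNorm_translate_nsmul_le (hp : 1 < p) {w : E → ℝ} (hw : AEStronglyMeasurable w volume)
    (z : E) (n : ℕ) :
    eLpNorm (fun x => w (x + n • z) - w x) (ENNReal.ofReal p) volume ≤
      n * eLpNorm (fun x => w (x + z) - w x) (ENNReal.ofReal p) volume := by
  have hm : ∀ y : E, AEStronglyMeasurable (fun x => w (x + y) - w x) volume := fun y =>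
    (hw.comp_measurePreserving (measurePreserving_add_right volume y)).sub hw
  induction n with
  | zero => simp
  | succ n ih =>
    have h1 : (fun x => w (x + (n + 1) • z) - w x) =
        (fun x => w (x + n • z) - w x) ∘ (fun x => x + z) + fun x => w (x + z) - w x := by
      funext x
      simp only [Pi.add_apply, Function.comp_apply]
      rw [succ_nsmul', add_assoc]
      ring
    rw [h1]
    refine (eLpNorm_add_le ((hm _).comp_measurePreserving (measurePreserving_add_right volume z))
      (hm z) (by simpa using hp.le)).trans ?_
    rw [eLpNorm_comp_measurePreserving (hm _) (measurePreserving_add_right volume z)]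
    push_cast
    rw [add_mul, one_mul]
    gcongr

/-- The nonlocal Poincaré inequality. -/
lemma exists_poincare (hN : 0 < N) (hp : 1 < p) (hs : 0 < s) (hc₀ : 0 < c₀) (hδ : 0 < δ)
    (hk : IsKernel N p s c₀ δ k) (hΩ : IsOpen Ω) (hΩb : Bornology.IsBounded Ω) :
    ∃ C : ℝ, 0 ≤ C ∧ ∀ w : E → ℝ, MemX Ω δ p k w → (∀ x ∉ Ω, w x = 0) →
      ∫ x, |w x| ^ p ≤ C * energy Ω δ p k (fun _ => 1) w := by
  have hp0 : 0 < p := by linarith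
  have : Nonempty (Fin N) := ⟨⟨0, hN⟩⟩
  obtain ⟨R, hR0, hR⟩ := hΩb.subset_ball_lt 0 (0 : E)
  -- After `n` steps longer than `δ / 2` every point of `Ω` has left the ball of radius `R`, hence
  -- `Ω`.
  obtain ⟨n, hn⟩ := exists_nat_gt (2 * R / (δ / 2))
  rw [div_lt_iff₀ (by positivity)] at hn
  -- Steps in this annulus are long enough for the choice of `n` and short enough for the kernel
  -- bound; the estimate for a single `z` is averaged over `A`.
  set A : Set E := Metric.ball 0 δ ∩ (Metric.closedBall 0 (δ / 2))ᶜ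
  have hAo : IsOpen A := Metric.isOpen_ball.inter Metric.isClosed_closedBall.isOpen_compl
  have hAne : A.Nonempty := by
    obtain ⟨z, hz⟩ := exists_norm_eq E (by positivity : 0 ≤ 3 / 4 * δ)
    refine ⟨z, ?_, ?_⟩
    · rw [mem_ball_zero_iff, hz]; linarith
    · rw [mem_compl_iff, mem_closedBall_zero_iff, hz]; linarith
  have hA0 : volume A ≠ 0 := (hAo.measure_pos volume hAne).ne'
  have hAt : volume A ≠ ⊤ :=
    ((measure_mono inter_subset_left).trans_lt measure_ball_lt_top).ne
  have hApos : 0 < (volume A).toReal := ENNReal.toReal_pos hA0 hAt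
  refine ⟨(n : ℝ) ^ p * (δ ^ ((N : ℝ) + s * p) / c₀) / (volume A).toReal, by positivity,
    fun w hw hw0 => ?_⟩
  have hwL := hw.memLp_of_zero_off hΩ hw0
  have key : ∀ z ∈ A, ∫⁻ x, ‖w x‖ₑ ^ p ≤
      ENNReal.ofReal ((n : ℝ) ^ p) * ∫⁻ x, ‖w (x + z) - w x‖ₑ ^ p := by
    intro z hz
    have hzn : δ / 2 < ‖z‖ := by simpa using hz.2
    -- If `x ∈ Ω`, then `w (x + n • z) = 0` and the increment is `-w x`; elsewhere `w x = 0`.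
    have h1 : eLpNorm w (ENNReal.ofReal p) volume ≤
        eLpNorm (fun x => w (x + n • z) - w x) (ENNReal.ofReal p) volume := by
      refine eLpNorm_mono fun x => ?_
      by_cases hx : x ∈ Ω
      · have hx' : x + n • z ∉ Ω := fun h => by
          have a1 := mem_ball_zero_iff.1 (hR hx)
          have a2 := mem_ball_zero_iff.1 (hR h)
          have a3 : ‖n • z‖ = n * ‖z‖ := by
            rw [← Nat.cast_smul_eq_nsmul ℝ, norm_smul, Real.norm_natCast]
          have a4 : ‖n • z‖ ≤ ‖x + n • z‖ + ‖x‖ := by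
            simpa using norm_sub_le (x + n • z) x
          have a5 : (n : ℝ) * (δ / 2) ≤ n * ‖z‖ := by gcongr
          linarith
        rw [hw0 _ hx', zero_sub, norm_neg]
      · rw [hw0 _ hx, norm_zero]; positivity
    have h2 := ENNReal.rpow_le_rpow (h1.trans (eLpNorm_translate_nsmul_le hp hwL.1 z n)) hp0.le
    rw [ENNReal.mul_rpow_of_nonneg _ _ hp0.le, rpow_eLpNorm hp, rpow_eLpNorm hp] at h2
    rwa [← ENNReal.ofReal_rpow_of_nonneg (by positivity) hp0.le, ENNReal.ofReal_natCast]
  have hmeas : AEMeasurable (Function.uncurry fun (z x : E) => ‖w (x + z) - w x‖ₑ ^ p)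
      ((volume.restrict A).prod volume) := by
    have h1 : AEMeasurable (fun q : E × E => w (q.2 + q.1)) ((volume.restrict A).prod volume) := by
      refine hwL.1.aemeasurable.comp_quasiMeasurePreserving ?_
      simpa only [add_comm] using quasiMeasurePreserving_add (volume.restrict A) volume
    exact (h1.sub hwL.1.aemeasurable.comp_snd).enorm.pow_const p
  have h3 : volume A * ∫⁻ x, ‖w x‖ₑ ^ p ≤ ENNReal.ofReal ((n : ℝ) ^ p) *
      (ENNReal.ofReal (δ ^ ((N : ℝ) + s * p) / c₀) *
        ENNReal.ofReal (energy Ω δ p k (fun _ => 1) w)) := by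
    calc volume A * ∫⁻ x, ‖w x‖ₑ ^ p = ∫⁻ _ in A, ∫⁻ x, ‖w x‖ₑ ^ p := by
          rw [setLIntegral_const, mul_comm]
      _ ≤ ∫⁻ z in A, ENNReal.ofReal ((n : ℝ) ^ p) * ∫⁻ x, ‖w (x + z) - w x‖ₑ ^ p :=
          setLIntegral_mono' hAo.measurableSet key
      _ = ENNReal.ofReal ((n : ℝ) ^ p) * ∫⁻ x, ∫⁻ z in A, ‖w (x + z) - w x‖ₑ ^ p := by
          rw [lintegral_const_mul' _ _ ENNReal.ofReal_ne_top, lintegral_lintegral_swap hmeas]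
      _ ≤ _ := by
          gcongr
          refine le_trans (lintegral_mono fun x => ?_)
            (lintegral_translate_le hp hs hc₀ hk hΩ hw hw0 hδ le_rfl)
          exact lintegral_mono_set inter_subset_left
  have hint := integrable_abs_rpow hp hwL
  have hen : 0 ≤ energy Ω δ p k (fun _ => 1) w := integral_nonneg fun z => by positivity
  have h4 : ∫⁻ x, ‖w x‖ₑ ^ p = ENNReal.ofReal (∫ x, |w x| ^ p) := by
    rw [ofReal_integral_eq_lintegral_ofReal hint (Eventually.of_forall fun x => by
      simp only [Pi.zero_apply]; positivity)]
    simp only [enorm_rpow_eq_ofReal hp]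
  rw [h4, ← ENNReal.ofReal_toReal hAt, ← ENNReal.ofReal_mul (by positivity),
    ← ENNReal.ofReal_mul (by positivity), ← ENNReal.ofReal_mul (by positivity),
    ENNReal.ofReal_le_ofReal_iff (by positivity)] at h3
  rw [div_mul_eq_mul_div, le_div_iff₀ hApos]
  linarith

/-! ### Compactness in `L^p` through averages over balls. -/

/-- The uniform probability measure on the ball of radius `r`. -/
noncomputable def ballMeasure (N : ℕ) (r : ℝ) : Measure (EuclideanSpace ℝ (Fin N)) :=
  ProbabilityTheory.cond volume (Metric.ball 0 r)

lemma isProbabilityMeasure_ballMeasure {r : ℝ} (hr : 0 < r) :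
    IsProbabilityMeasure (ballMeasure N r) :=
  ProbabilityTheory.cond_isProbabilityMeasure_of_finite
    (Metric.isOpen_ball.measure_pos volume ⟨0, by simpa using hr⟩).ne' measure_ball_lt_top.ne

lemma lintegral_ballMeasure (r : ℝ) (f : E → ENNReal) :
    ∫⁻ z, f z ∂ballMeasure N r =
      (volume (Metric.ball (0 : E) r))⁻¹ * ∫⁻ z in Metric.ball (0 : E) r, f z := by
  rw [ballMeasure, ProbabilityTheory.cond, lintegral_smul_measure, smul_eq_mul]

lemma ballMeasure_absolutelyContinuous (r : ℝ) : ballMeasure N r ≪ volume :=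
  ProbabilityTheory.cond_absolutelyContinuous

/-- The average of `w` over the ball `B(x, r)`. -/
noncomputable def ballAverage (r : ℝ) (w : E → ℝ) (x : E) : ℝ := ∫ z, w (x + z) ∂ballMeasure N r

lemma aestronglyMeasurable_translate {w : E → ℝ} (hw : AEStronglyMeasurable w volume) (x : E)
    (r : ℝ) : AEStronglyMeasurable (fun z => w (x + z)) (ballMeasure N r) :=
  (hw.comp_measurePreserving (measurePreserving_add_left volume x)).mono_ac
    (ballMeasure_absolutelyContinuous r)

lemma lintegral_translate_ballMeasure_le (r : ℝ) (w : E → ℝ) (x : E) :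
    ∫⁻ z, ‖w (x + z)‖ₑ ^ p ∂ballMeasure N r ≤
      (volume (Metric.ball (0 : E) r))⁻¹ * ∫⁻ z, ‖w z‖ₑ ^ p := by
  rw [lintegral_ballMeasure]
  refine mul_le_mul_right ((setLIntegral_le_lintegral _ _).trans ?_) _
  rw [lintegral_add_left_eq_self (fun z => ‖w z‖ₑ ^ p) x]

lemma enorm_ballAverage_rpow_le (hp : 1 < p) {w : E → ℝ} (hw : AEStronglyMeasurable w volume)
    {r : ℝ} (hr : 0 < r) (x : E) :
    ‖ballAverage r w x‖ₑ ^ p ≤ (volume (Metric.ball (0 : E) r))⁻¹ * ∫⁻ z, ‖w z‖ₑ ^ p := by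
  have := isProbabilityMeasure_ballMeasure (N := N) hr
  exact (enorm_integral_rpow_le hp (aestronglyMeasurable_translate hw x r)).trans
    (lintegral_translate_ballMeasure_le r w x)

lemma integrable_translate (hp : 1 < p) {w : E → ℝ} (hw : MemLp w (ENNReal.ofReal p) volume)
    {r : ℝ} (hr : 0 < r) (x : E) : Integrable (fun z => w (x + z)) (ballMeasure N r) := by
  have := isProbabilityMeasure_ballMeasure (N := N) hr
  have hp0 : 0 < p := by linarith
  have hmem : MemLp (fun z => w (x + z)) (ENNReal.ofReal p) (ballMeasure N r) := by
    refine ⟨aestronglyMeasurable_translate hw.1 x r, ?_⟩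
    rw [← ENNReal.rpow_lt_top_iff_of_pos hp0, rpow_eLpNorm hp]
    refine (lintegral_translate_ballMeasure_le r w x).trans_lt ?_
    rw [lintegral_enorm_rpow_eq hp hw]
    refine ENNReal.mul_lt_top (ENNReal.inv_lt_top.2 ?_) ENNReal.ofReal_lt_top
    exact Metric.isOpen_ball.measure_pos volume ⟨0, by simpa using hr⟩
  exact hmem.integrable (by simpa using hp.le)

lemma aestronglyMeasurable_ballAverage {w : E → ℝ} (hw : AEStronglyMeasurable w volume) {r : ℝ}
    (hr : 0 < r) : AEStronglyMeasurable (ballAverage r w) volume := by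
  have := isProbabilityMeasure_ballMeasure (N := N) hr
  have h : AEStronglyMeasurable (fun q : E × E => w (q.1 + q.2))
      (volume.prod (ballMeasure N r)) := by
    refine hw.comp_quasiMeasurePreserving ?_
    refine (quasiMeasurePreserving_add (volume : Measure E) (volume : Measure E)).mono_left ?_
    exact Measure.AbsolutelyContinuous.rfl.prod (ballMeasure_absolutelyContinuous r)
  exact h.integral_prod_right'

/-- Jensen applied to `w - ballAverage r w`, which is up to sign the average of the increments `w (x
+ z) - w x`. -/
lemma lintegral_sub_ballAverage_le (hp : 1 < p) {w : E → ℝ} (hw : MemLp w (ENNReal.ofReal p) volume)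
    {r : ℝ} (hr : 0 < r) :
    ∫⁻ x, ‖w x - ballAverage r w x‖ₑ ^ p ≤ (volume (Metric.ball (0 : E) r))⁻¹ *
      ∫⁻ x, ∫⁻ z in Metric.ball (0 : E) r, ‖w (x + z) - w x‖ₑ ^ p := by
  have := isProbabilityMeasure_ballMeasure (N := N) hr
  have hne : (volume (Metric.ball (0 : E) r))⁻¹ ≠ ⊤ :=
    ENNReal.inv_ne_top.2 (Metric.isOpen_ball.measure_pos volume ⟨0, by simpa using hr⟩).ne'
  rw [← lintegral_const_mul' _ _ hne]
  refine lintegral_mono fun x => ?_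
  have h1 := integrable_translate hp hw hr x
  have h2 : ballAverage r w x - w x = ∫ z, (w (x + z) - w x) ∂ballMeasure N r := by
    rw [integral_sub h1 (integrable_const _)]
    simp [ballAverage]
  rw [← enorm_neg, neg_sub, h2, ← lintegral_ballMeasure]
  exact enorm_integral_rpow_le hp (h1.sub (integrable_const _)).1

/-- A sequence bounded in `L^p` has a subsequence whose averages over balls converge. -/
lemma exists_subseq_tendsto_ballAverage (hp : 1 < p) {w : ℕ → E → ℝ}
    (hw : ∀ j, MemLp (w j) (ENNReal.ofReal p) volume) {M : ℝ} (hM : ∀ j, ∫ x, |w j x| ^ p ≤ M) :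
    ∃ φ : ℕ → ℕ, StrictMono φ ∧ ∀ r : ℝ, ∀ x : E,
      ∃ a : ℝ, Tendsto (fun j => ballAverage r (w (φ j)) x) atTop (𝓝 a) := by
  have hpq : p.HolderConjugate (p / (p - 1)) := Real.HolderConjugate.conjExponent hp
  set q := p / (p - 1)
  have hM0 : 0 ≤ M := le_trans (integral_nonneg fun z => by positivity) (hM 0)
  have : Fact (1 ≤ ENNReal.ofReal p) := ⟨by simpa using hp.le⟩
  have : Fact (1 ≤ ENNReal.ofReal q) := ⟨by simpa using hpq.symm.lt.le⟩
  have : Fact (ENNReal.ofReal q ≠ ⊤) := ⟨ENNReal.ofReal_ne_top⟩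
  have : ENNReal.HolderConjugate (ENNReal.ofReal p) (ENNReal.ofReal q) := hpq.ennrealOfReal
  set B := (ContinuousLinearMap.mul ℝ ℝ).lpPairing (volume : Measure E) (ENNReal.ofReal p)
    (ENNReal.ofReal q)
  -- The `w j` act as bounded functionals on `L^q`. Weak-* sequential compactness gives one
  -- subsequence serving all balls at once, since an average is a normalized pairing with an
  -- indicator.
  set T : ℕ → WeakDual ℝ (Lp ℝ (ENNReal.ofReal q) (volume : Measure E)) :=
    fun j => StrongDual.toWeakDual (B ((hw j).toLp (w j)))
  have hT : ∀ j, T j ∈ WeakDual.toStrongDual ⁻¹'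
      Metric.closedBall (0 : StrongDual ℝ (Lp ℝ (ENNReal.ofReal q) (volume : Measure E)))
        (‖B‖ * M ^ p⁻¹) := by
    intro j
    simp only [mem_preimage, mem_closedBall_zero_iff]
    refine (B.le_opNorm _).trans ?_
    gcongr
    rw [Real.le_rpow_inv_iff_of_pos (norm_nonneg _) hM0 (by linarith), norm_toLp_rpow hp]
    exact hM j
  obtain ⟨S, -, φ, hφ, hS⟩ := WeakDual.isSeqCompact_closedBall ℝ _ _ _ hT
  refine ⟨φ, hφ, fun r x => ?_⟩
  set I : E → ℝ := (Metric.ball x r).indicator fun _ => 1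
  have hI : MemLp I (ENNReal.ofReal q) volume :=
    memLp_indicator_const _ Metric.isOpen_ball.measurableSet _ (Or.inr measure_ball_lt_top.ne)
  have hlim : Tendsto (fun j => T (φ j) (hI.toLp I)) atTop (𝓝 (S (hI.toLp I))) :=
    ((WeakDual.eval_continuous (hI.toLp I)).tendsto S).comp hS
  refine ⟨((volume (Metric.ball (0 : E) r))⁻¹).toReal * S (hI.toLp I),
    (hlim.const_mul _).congr fun j => ?_⟩
  have h1 : T (φ j) (hI.toLp I) = ∫ y, w (φ j) y * I y := by
    change B _ _ = _
    rw [ContinuousLinearMap.lpPairing_eq_integral]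
    refine integral_congr_ae ?_
    filter_upwards [hI.coeFn_toLp, (hw (φ j)).coeFn_toLp] with y hy hy'
    simp [hy, hy']
  rw [h1, ballAverage, ballMeasure, ProbabilityTheory.cond, integral_smul_measure, smul_eq_mul,
    ← integral_indicator Metric.isOpen_ball.measurableSet,
    ← integral_add_left_eq_self (fun y => w (φ j) y * I y) x]
  congr 2
  funext z
  by_cases hz : z ∈ Metric.ball (0 : E) r
  · have : x + z ∈ Metric.ball x r := by simpa [dist_eq_norm] using hz
    simp only [I]
    rw [indicator_of_mem hz, indicator_of_mem this, mul_one]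
  · have : x + z ∉ Metric.ball x r := by simpa [dist_eq_norm] using hz
    simp only [I]
    rw [indicator_of_notMem hz, indicator_of_notMem this, mul_zero]

/-- Pointwise convergence of averages over balls, for a sequence bounded in `L^p`, improves to
convergence in `L^p` on sets of finite measure. -/
lemma tendsto_eLpNorm_ballAverage (hp : 1 < p) {w : ℕ → E → ℝ}
    (hw : ∀ j, MemLp (w j) (ENNReal.ofReal p) volume) {M : ℝ} (hM : ∀ j, ∫ x, |w j x| ^ p ≤ M)
    {r : ℝ} (hr : 0 < r) {a : E → ℝ}
    (ha : ∀ x, Tendsto (fun j => ballAverage r (w j) x) atTop (𝓝 (a x))) {A : Set E}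
    (hA : volume A ≠ ⊤) :
    Tendsto (fun j => eLpNorm (ballAverage r (w j) - a) (ENNReal.ofReal p) (volume.restrict A))
      atTop (𝓝 0) := by
  have hp0 : 0 < p := by linarith
  set K : ENNReal := (volume (Metric.ball (0 : E) r))⁻¹ * ENNReal.ofReal M
  have hK : K ≠ ⊤ := ENNReal.mul_ne_top (ENNReal.inv_ne_top.2
    (Metric.isOpen_ball.measure_pos volume ⟨0, by simpa using hr⟩).ne') ENNReal.ofReal_ne_top
  have hb : ∀ j x, ‖ballAverage r (w j) x‖ₑ ^ p ≤ K := fun j x => by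
    refine (enorm_ballAverage_rpow_le hp (hw j).1 hr x).trans ?_
    rw [lintegral_enorm_rpow_eq hp (hw j)]
    exact mul_le_mul_right (ENNReal.ofReal_le_ofReal (hM j)) _
  have hba : ∀ x, ‖a x‖ₑ ^ p ≤ K := fun x =>
    le_of_tendsto' ((ENNReal.continuous_rpow_const.tendsto _).comp (ha x).enorm) fun j => hb j x
  have hmeas : ∀ j, AEStronglyMeasurable (ballAverage r (w j)) (volume.restrict A) := fun j =>
    (aestronglyMeasurable_ballAverage (hw j).1 hr).restrict
  have hameas : AEStronglyMeasurable a (volume.restrict A) :=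
    aestronglyMeasurable_of_tendsto_ae atTop hmeas (Eventually.of_forall ha)
  have h1 : Tendsto (fun j => ∫⁻ x in A, ‖(ballAverage r (w j) - a) x‖ₑ ^ p) atTop (𝓝 0) := by
    rw [← lintegral_zero (μ := volume.restrict A)]
    -- By Jensen the averages are bounded by a constant independent of `j` and `x`, which is
    -- integrable on a set of finite measure.
    refine tendsto_lintegral_of_dominated_convergence' (fun _ => 2 ^ (p - 1) * (K + K))
      (fun j => ((hmeas j).sub hameas).enorm.pow_const p)
      (fun j => Eventually.of_forall fun x => ?_) ?_ (Eventually.of_forall fun x => ?_)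
    · refine (ENNReal.rpow_le_rpow (enorm_sub_le) hp0.le).trans ?_
      refine (ENNReal.rpow_add_le_mul_rpow_add_rpow _ _ hp.le).trans ?_
      exact mul_le_mul_right (add_le_add (hb j x) (hba x)) _
    · rw [setLIntegral_const]
      exact ENNReal.mul_ne_top (ENNReal.mul_ne_top (by simp) (by simpa using hK)) hA
    · have h2 : Tendsto (fun j => ‖(ballAverage r (w j) - a) x‖ₑ) atTop (𝓝 0) := by
        have := ((ha x).sub_const (a x)).enorm
        simpa using this
      have h3 := ((ENNReal.continuous_rpow_const (y := p)).tendsto _).comp h2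
      rwa [ENNReal.zero_rpow_of_pos hp0] at h3
  have h4 := ((ENNReal.continuous_rpow_const (y := p⁻¹)).tendsto _).comp h1
  rw [ENNReal.zero_rpow_of_pos (inv_pos.2 hp0)] at h4
  refine h4.congr fun j => ?_
  simp only [Function.comp_apply]
  rw [← rpow_eLpNorm hp, ENNReal.rpow_rpow_inv hp0.ne']

/-- Functions vanishing off `Ω` are approximated in `L^p` by their averages over small balls,
uniformly on sets of bounded energy. -/
lemma exists_eLpNorm_sub_ballAverage_le (hN : 0 < N) (hp : 1 < p) (hs : 0 < s) (hc₀ : 0 < c₀)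
    (hδ : 0 < δ) (hk : IsKernel N p s c₀ δ k) (hΩ : IsOpen Ω) (M : ℝ) {ε : ENNReal} (hε : 0 < ε) :
    ∃ r : ℝ, 0 < r ∧ ∀ w : E → ℝ, MemX Ω δ p k w → (∀ x ∉ Ω, w x = 0) →
      energy Ω δ p k (fun _ => 1) w ≤ M →
      eLpNorm (w - ballAverage r w) (ENNReal.ofReal p) volume ≤ ε := by
  have hp0 : 0 < p := by linarith
  have : Nonempty (Fin N) := ⟨⟨0, hN⟩⟩
  set V := volume (Metric.ball (0 : E) 1)
  have hV : V ≠ 0 := (Metric.isOpen_ball.measure_pos volume ⟨0, by simp⟩).ne'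
  set K : ENNReal := V⁻¹ * ENNReal.ofReal (c₀⁻¹) * ENNReal.ofReal M
  have hK : K ≠ ⊤ := ENNReal.mul_ne_top (ENNReal.mul_ne_top (ENNReal.inv_ne_top.2 hV)
    ENNReal.ofReal_ne_top) ENNReal.ofReal_ne_top
  -- The translation estimate carries `r ^ (N + s p)` and the average divides by a volume of order
  -- `r ^ N`; the remaining `r ^ (s p)` tends to zero because `s > 0`.
  have hlim : Tendsto (fun r : ℝ => ENNReal.ofReal (r ^ (s * p)) * K) (𝓝[>] 0) (𝓝 0) := by
    have h1 : Tendsto (fun r : ℝ => r ^ (s * p)) (𝓝[>] 0) (𝓝 0) := by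
      have h := (Real.continuousAt_rpow_const 0 (s * p) (Or.inr (by positivity))).tendsto
      rw [Real.zero_rpow (by positivity)] at h
      exact h.mono_left nhdsWithin_le_nhds
    have h2 := ENNReal.Tendsto.mul_const (ENNReal.tendsto_ofReal h1) (Or.inr hK)
    simpa using h2
  have hεp : (0 : ENNReal) < ε ^ p := by
    rcases eq_or_ne ε ⊤ with rfl | h
    · simp [ENNReal.top_rpow_of_pos hp0]
    · exact ENNReal.rpow_pos hε h
  obtain ⟨r, hr, hr1⟩ := ((hlim.eventually_lt_const hεp).and
    (Ioo_mem_nhdsGT hδ)).exists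
  refine ⟨r, hr1.1, fun w hw hw0 hM => ?_⟩
  rw [← ENNReal.rpow_le_rpow_iff hp0, rpow_eLpNorm hp]
  refine ((lintegral_sub_ballAverage_le hp (hw.memLp_of_zero_off hΩ hw0) hr1.1).trans ?_).trans hr.le
  have h1 := lintegral_translate_le hp hs hc₀ hk hΩ hw hw0 hr1.1 hr1.2.le
  have hrN : 0 < r ^ N := pow_pos hr1.1 N
  calc _ ≤ (volume (Metric.ball (0 : E) r))⁻¹ * (ENNReal.ofReal (r ^ ((N : ℝ) + s * p) / c₀) *
        ENNReal.ofReal M) := by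
        gcongr
        exact h1.trans (mul_le_mul_right (ENNReal.ofReal_le_ofReal hM) _)
    _ = ENNReal.ofReal (r ^ (s * p)) * K := by
        rw [Measure.addHaar_ball _ _ hr1.1.le, finrank_euclideanSpace_fin,
          ENNReal.mul_inv (Or.inl (by simpa using hrN)) (Or.inl ENNReal.ofReal_ne_top),
          ← ENNReal.ofReal_inv_of_pos hrN, Real.rpow_add hr1.1, Real.rpow_natCast]
        have h2 : ENNReal.ofReal (r ^ N * r ^ (s * p) / c₀) =
            ENNReal.ofReal (r ^ N) * ENNReal.ofReal (r ^ (s * p)) * ENNReal.ofReal (c₀⁻¹) := by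
          rw [← ENNReal.ofReal_mul hrN.le, ← ENNReal.ofReal_mul (by
            have := hr1.1; positivity), div_eq_mul_inv]
        have h3 : ENNReal.ofReal ((r ^ N)⁻¹) * ENNReal.ofReal (r ^ N) = 1 := by
          rw [← ENNReal.ofReal_mul (by positivity), inv_mul_cancel₀ hrN.ne', ENNReal.ofReal_one]
        rw [h2]
        calc _ = (ENNReal.ofReal ((r ^ N)⁻¹) * ENNReal.ofReal (r ^ N)) *
              (ENNReal.ofReal (r ^ (s * p)) * K) := by simp only [K, V]; ring
          _ = _ := by rw [h3, one_mul]

/-- Sequences of bounded energy that vanish off `Ω` are precompact in `L^p`. -/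
lemma exists_subseq_tendsto_of_energy_le (hN : 0 < N) (hp : 1 < p) (hs : 0 < s) (hc₀ : 0 < c₀)
    (hδ : 0 < δ) (hk : IsKernel N p s c₀ δ k) (hΩ : IsOpen Ω) (hΩb : Bornology.IsBounded Ω)
    {w : ℕ → E → ℝ} (hw : ∀ j, MemX Ω δ p k (w j)) (hw0 : ∀ j, ∀ x ∉ Ω, w j x = 0) {M : ℝ}
    (hM : ∀ j, energy Ω δ p k (fun _ => 1) (w j) ≤ M) :
    ∃ φ : ℕ → ℕ, StrictMono φ ∧ ∃ v : E → ℝ, MemLp v (ENNReal.ofReal p) volume ∧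
      (∀ x ∉ Ω, v x = 0) ∧
      Tendsto (fun j => eLpNorm (w (φ j) - v) (ENNReal.ofReal p) volume) atTop (𝓝 0) := by
  have : Fact (1 ≤ ENNReal.ofReal p) := ⟨by simpa using hp.le⟩
  have hp1 : 1 ≤ ENNReal.ofReal p := by simpa using hp.le
  obtain ⟨C, hC0, hC⟩ := exists_poincare hN hp hs hc₀ hδ hk hΩ hΩb
  have hwL : ∀ j, MemLp (w j) (ENNReal.ofReal p) volume := fun j =>
    (hw j).memLp_of_zero_off hΩ (hw0 j)
  have hwM : ∀ j, ∫ x, |w j x| ^ p ≤ C * M := fun j =>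
    (hC _ (hw j) (hw0 j)).trans (mul_le_mul_of_nonneg_left (hM j) hC0)
  obtain ⟨φ, hφ, hlim⟩ := exists_subseq_tendsto_ballAverage hp hwL hwM
  choose a ha using hlim
  have hwR : ∀ j, MemLp (w (φ j)) (ENNReal.ofReal p) (volume.restrict Ω) := fun j =>
    (hwL _).restrict Ω
  -- `w (φ m)` and `w (φ n)` are compared through their averages and the limit `a r` of these; each
  -- of the four differences costs `ε'`. The radius is fixed first, uniformly in `j`.
  have hcauchy : CauchySeq fun j => (hwR j).toLp (w (φ j)) := by
    rw [EMetric.cauchySeq_iff]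
    intro ε hε
    obtain ⟨ε', hε', hεε⟩ : ∃ ε' : ENNReal, 0 < ε' ∧ ε' + ε' + (ε' + ε') < ε := by
      obtain ⟨b, hb0, hb⟩ := exists_between hε
      refine ⟨b / 2 / 2, by simpa using hb0.ne', ?_⟩
      rwa [ENNReal.add_halves, ENNReal.add_halves]
    obtain ⟨r, hr, happ⟩ := exists_eLpNorm_sub_ballAverage_le hN hp hs hc₀ hδ hk hΩ M hε'
    have hΩt : volume Ω ≠ ⊤ := hΩb.measure_lt_top.ne
    obtain ⟨n₀, hn₀⟩ := eventually_atTop.1 ((tendsto_eLpNorm_ballAverage hp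
      (fun j => hwL (φ j)) (fun j => hwM (φ j)) hr (ha r) hΩt).eventually_le_const hε')
    have hAm : ∀ j, AEStronglyMeasurable (ballAverage r (w (φ j))) (volume.restrict Ω) := fun j =>
      (aestronglyMeasurable_ballAverage (hwL (φ j)).1 hr).restrict
    have ham : AEStronglyMeasurable (a r) (volume.restrict Ω) :=
      aestronglyMeasurable_of_tendsto_ae atTop hAm (Eventually.of_forall (ha r))
    have hdist : ∀ j, n₀ ≤ j →
        eLpNorm (w (φ j) - a r) (ENNReal.ofReal p) (volume.restrict Ω) ≤ ε' + ε' := by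
      intro j hj
      have h1 : w (φ j) - a r = (w (φ j) - ballAverage r (w (φ j))) +
          (ballAverage r (w (φ j)) - a r) := by abel
      rw [h1]
      refine (eLpNorm_add_le ((hwR j).1.sub (hAm j)) ((hAm j).sub ham) hp1).trans ?_
      exact add_le_add ((eLpNorm_mono_measure _ Measure.restrict_le_self).trans
        (happ _ (hw _) (hw0 _) (hM _))) (hn₀ j hj)
    refine ⟨n₀, fun m hm n hn => lt_of_le_of_lt ?_ hεε⟩
    rw [Lp.edist_toLp_toLp]
    have h2 : w (φ m) - w (φ n) = (w (φ m) - a r) - (w (φ n) - a r) := by abel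
    rw [h2]
    exact (eLpNorm_sub_le ((hwR m).1.sub ham) ((hwR n).1.sub ham) hp1).trans
      (add_le_add (hdist m hm) (hdist n hn))
  obtain ⟨f, hf⟩ := cauchySeq_tendsto_of_complete hcauchy
  refine ⟨φ, hφ, Ω.indicator f, ?_, fun x hx => indicator_of_notMem hx _, ?_⟩
  · exact (memLp_indicator_iff_restrict hΩ.measurableSet).2 (Lp.memLp f)
  · have h3 : Tendsto (fun j => eLpNorm (w (φ j) - (f : E → ℝ)) (ENNReal.ofReal p) (volume.restrict Ω))
        atTop (𝓝 0) := by
      rw [← Lp.toLp_coeFn f (Lp.memLp f)] at hf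
      exact (Lp.tendsto_Lp_iff_tendsto_eLpNorm'' _ hwR _ (Lp.memLp f)).1 hf
    refine h3.congr fun j => ?_
    rw [← eLpNorm_indicator_eq_eLpNorm_restrict hΩ.measurableSet]
    congr 1
    funext x
    by_cases hx : x ∈ Ω
    · simp [hx]
    · simp [hx, hw0 _ x hx]

lemma MemX₀.indicator (hp : 1 < p) (hk : IsKernel N p s c₀ δ k) (hΩ : IsOpen Ω) {w : E → ℝ}
    (hw : MemX₀ Ω δ p k w) : MemX Ω δ p k (Ω.indicator w) :=
  hw.1.congr hp hk (ae_eq_indicator_of_eqOutside hΩ hw.2)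

lemma eqOutside_of_zero_off (hΩ : IsOpen Ω) {v : E → ℝ} (hv : ∀ x ∉ Ω, v x = 0) :
    EqOutside Ω δ v 0 := by
  filter_upwards [ae_restrict_mem
    ((isOpen_extendedDomain hΩ δ).measurableSet.diff hΩ.measurableSet)] with x hx
  exact hv x hx.2

/-- Compactness of bounded sets of `X₀` in `L^p(Ω_δ)`. -/
lemma exists_subseq_tendsto_memX₀ (hN : 0 < N) (hp : 1 < p) (hs : 0 < s) (hc₀ : 0 < c₀)
    (hδ : 0 < δ) (hk : IsKernel N p s c₀ δ k) (hΩ : IsOpen Ω) (hΩb : Bornology.IsBounded Ω)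
    {w : ℕ → E → ℝ} (hw : ∀ j, MemX₀ Ω δ p k (w j)) {M : ℝ}
    (hM : ∀ j, energy Ω δ p k (fun _ => 1) (w j) ≤ M) :
    ∃ φ : ℕ → ℕ, StrictMono φ ∧ ∃ v : E → ℝ, MemX₀ Ω δ p k v ∧
      Tendsto (fun j => eLpNorm (w (φ j) - v) (ENNReal.ofReal p)
        (volume.restrict (extendedDomain Ω δ))) atTop (𝓝 0) ∧
      ∀ᵐ x ∂volume.restrict (extendedDomain Ω δ),
        Tendsto (fun j => w (φ j) x) atTop (𝓝 (v x)) := by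
  have hae : ∀ j, w j =ᵐ[volume.restrict (extendedDomain Ω δ)] Ω.indicator (w j) := fun j =>
    ae_eq_indicator_of_eqOutside hΩ (hw j).2
  obtain ⟨φ, hφ, v, hvL, hv0, hlim⟩ := exists_subseq_tendsto_of_energy_le hN hp hs hc₀ hδ hk hΩ hΩb
    (w := fun j => Ω.indicator (w j)) (fun j => (hw j).indicator hp hk hΩ)
    (fun j x hx => indicator_of_notMem hx _) (M := M)
    (fun j => (energy_congr (hae j)).symm.trans_le (hM j))
  have hlim2 : Tendsto (fun j => eLpNorm (w (φ j) - v) (ENNReal.ofReal p)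
      (volume.restrict (extendedDomain Ω δ))) atTop (𝓝 0) := by
    refine tendsto_of_tendsto_of_tendsto_of_le_of_le tendsto_const_nhds hlim (fun _ => zero_le)
      fun j => ?_
    rw [eLpNorm_congr_ae ((hae (φ j)).sub (ae_eq_refl v))]
    exact eLpNorm_mono_measure _ Measure.restrict_le_self
  obtain ⟨ψ, hψ, hψlim⟩ := (tendstoInMeasure_of_tendsto_eLpNorm
    (by simpa using (by linarith : 0 < p)) (fun j => (hw (φ j)).1.1.1) hvL.1.restrict
    hlim2).exists_seq_tendsto_ae
  refine ⟨φ ∘ ψ, hφ.comp hψ, v, ⟨(memX_iff hp hk).2 ⟨hvL.restrict _, ?_⟩,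
    eqOutside_of_zero_off hΩ hv0⟩, hlim2.comp hψ.tendsto_atTop, hψlim⟩
  refine (memLp_and_integral_le_of_tendsto_ae hp
    (U := fun j z => w (φ (ψ j)) z.1 - w (φ (ψ j)) z.2) (M := M)
    (μ := formMeasure Ω δ p k fun _ => 1)
    (fun j => ((memX_iff hp hk).1 (hw _).1).2) ?_ (Eventually.of_forall fun j => hM (φ (ψ j)))).1
  filter_upwards [ae_formMeasure_of_ae hψlim] with z hz
  exact hz.1.sub hz.2

/-! ### Existence of a state and energy bounds. -/

lemma energy_nonneg (h u : E → ℝ) : 0 ≤ energy Ω δ p k h u :=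
  integral_nonneg fun z => by positivity

lemma energy_add_le (hp : 1 < p) (hk : IsKernel N p s c₀ δ k) (hΩ : IsOpen Ω)
    (hmin_pos : 0 < hmin) (hlt : hmin < hmax) (hh : MemH Ω δ hmin hmax h) {u v : E → ℝ}
    (hu : MemX Ω δ p k u) (hv : MemX Ω δ p k v) :
    energy Ω δ p k h (fun x => u x + v x) ≤
      2 ^ (p - 1) * (energy Ω δ p k h u + energy Ω δ p k h v) := by
  refine le_of_eq_of_le ?_ (integral_abs_add_rpow_le hp
    (hu.memLp_increment hp hk hΩ hmin_pos hlt hh) (hv.memLp_increment hp hk hΩ hmin_pos hlt hh))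
  refine integral_congr_ae (Eventually.of_forall fun z => ?_)
  simp only
  congr 2
  ring

lemma energy_neg (h u : E → ℝ) : energy Ω δ p k h (fun x => -u x) = energy Ω δ p k h u := by
  refine integral_congr_ae (Eventually.of_forall fun z => ?_)
  simp only
  rw [← abs_neg]
  congr 2
  ring

lemma energy_sub_le (hp : 1 < p) (hk : IsKernel N p s c₀ δ k) (hΩ : IsOpen Ω)
    (hmin_pos : 0 < hmin) (hlt : hmin < hmax) (hh : MemH Ω δ hmin hmax h) {u v : E → ℝ}
    (hu : MemX Ω δ p k u) (hv : MemX Ω δ p k v) :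
    energy Ω δ p k h (fun x => u x - v x) ≤
      2 ^ (p - 1) * (energy Ω δ p k h u + energy Ω δ p k h v) := by
  have hv' : MemX Ω δ p k fun x => -v x := by
    have := hv.const_mul hp hk (-1)
    simpa using this
  have := energy_add_le hp hk hΩ hmin_pos hlt hh hu hv'
  rw [energy_neg] at this
  simpa only [← sub_eq_add_neg] using this

lemma MemX₀.of_sub (hp : 1 < p) (hk : IsKernel N p s c₀ δ k) {u v : E → ℝ}
    (hu : MemX Ω δ p k u) (hv : MemX Ω δ p k v) (huv : EqOutside Ω δ u v) :
    MemX₀ Ω δ p k fun x => u x - v x :=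
  ⟨hu.sub hp hk hv, huv.mono fun x hx => by simp [hx]⟩

/-- The direct method: the nonlocal problem with zero source has a solution. -/
lemma exists_isState_zero (hN : 0 < N) (hp : 1 < p) (hs : 0 < s) (hc₀ : 0 < c₀)
    (hδ : 0 < δ) (hk : IsKernel N p s c₀ δ k) (hΩ : IsOpen Ω) (hΩb : Bornology.IsBounded Ω)
    (hmin_pos : 0 < hmin) (hlt : hmin < hmax) (hh : MemH Ω δ hmin hmax h)
    (hu₀ : ∃ w, MemX Ω δ p k w ∧ EqOutside Ω δ w u₀) :
    ∃ u, IsState Ω δ p k h u₀ 0 u := by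
  obtain ⟨b, hb, hbu⟩ := hu₀
  -- The energy is minimized over `b + X₀`, the functions with the prescribed exterior values.
  set S : Set ℝ := {e | ∃ w, MemX₀ Ω δ p k w ∧ e = energy Ω δ p k h fun x => b x + w x}
  have hSb : BddBelow S := ⟨0, by rintro _ ⟨w, -, rfl⟩; exact energy_nonneg _ _⟩
  have hzero : MemX₀ Ω δ p k fun x => b x - b x :=
    MemX₀.of_sub hp hk hb hb (Eventually.of_forall fun _ => rfl)
  have hSne : S.Nonempty := ⟨_, _, hzero, rfl⟩
  set m := sInf S
  have hex : ∀ j : ℕ, ∃ w, MemX₀ Ω δ p k w ∧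
      energy Ω δ p k h (fun x => b x + w x) < m + 1 / ((j : ℝ) + 1) := by
    intro j
    obtain ⟨_, ⟨w, hw, rfl⟩, hlt⟩ := exists_lt_of_csInf_lt hSne
      (lt_add_of_pos_right m (by positivity : 0 < 1 / ((j : ℝ) + 1)))
    exact ⟨w, hw, hlt⟩
  choose w hw hwm using hex
  have hwm1 : ∀ j, energy Ω δ p k h (fun x => b x + w j x) ≤ m + 1 := fun j => by
    have : 1 / ((j : ℝ) + 1) ≤ 1 := by
      rw [div_le_one (by positivity)]; linarith [(Nat.cast_nonneg j : (0 : ℝ) ≤ j)]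
    linarith [hwm j]
  have hM : ∀ j, energy Ω δ p k (fun _ => 1) (w j) ≤
      2 / hmin * (2 ^ (p - 1) * (m + 1 + energy Ω δ p k h b)) := fun j => by
    refine (energy_one_le hp hk hΩ hmin_pos hlt hh (hw j)).trans ?_
    have := energy_sub_le hp hk hΩ hmin_pos hlt hh (hb.add hp hk (hw j).1) hb
    simp only [add_sub_cancel_left] at this
    have h2 := hwm1 j
    refine mul_le_mul_of_nonneg_left (this.trans ?_) (by positivity)
    gcongr
  obtain ⟨φ, hφ, v, hv, -, hlim⟩ := exists_subseq_tendsto_memX₀ hN hp hs hc₀ hδ hk hΩ hΩb hw hM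
  have hu : MemX Ω δ p k fun x => b x + v x := hb.add hp hk hv.1
  -- Fatou along the subsequence: the limit attains the infimum.
  have hle : energy Ω δ p k h (fun x => b x + v x) ≤ m := by
    refine le_of_forall_pos_le_add fun ε hε => ?_
    refine (memLp_and_integral_le_of_tendsto_ae hp
      (U := fun j z => (b z.1 + w (φ j) z.1) - (b z.2 + w (φ j) z.2))
      (fun j => (hb.add hp hk (hw (φ j)).1).memLp_increment hp hk hΩ hmin_pos hlt hh) ?_ ?_).2
    · filter_upwards [ae_formMeasure_of_ae hlim] with z hz
      exact (hz.1.const_add _).sub (hz.2.const_add _)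
    · have h1 := (tendsto_one_div_add_atTop_nhds_zero_nat (𝕜 := ℝ)).comp hφ.tendsto_atTop
      filter_upwards [h1.eventually_le_const hε] with j hj
      simp only [Function.comp_apply] at hj
      exact (hwm (φ j)).le.trans (by linarith)
  refine ⟨fun x => b x + v x, hu, ?_, fun w' hw' => ?_⟩
  · filter_upwards [hbu, hv.2] with x hx hx'
    rw [hx, hx']; simp
  · rw [weightedForm_eq hk hh.1 (hh.nonneg hΩ hmin_pos)]
    simp only [Pi.zero_apply, zero_mul, integral_zero]
    refine integral_signedPow_mul_eq_zero hp (hu.memLp_increment hp hk hΩ hmin_pos hlt hh)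
      (hw'.1.memLp_increment hp hk hΩ hmin_pos hlt hh) fun t => hle.trans ?_
    have hmem : MemX₀ Ω δ p k fun x => v x + t * w' x := by
      refine ⟨hv.1.add hp hk (hw'.1.const_mul hp hk t), ?_⟩
      filter_upwards [hv.2, hw'.2] with x hx hx'
      rw [hx, hx']; simp
    refine (csInf_le hSb ⟨_, hmem, rfl⟩).trans_eq ?_
    refine integral_congr_ae (Eventually.of_forall fun z => ?_)
    simp only
    congr 2
    ring

lemma setIntegral_abs_rpow_eq (hΩ : IsOpen Ω) (hp : 1 < p) (w : E → ℝ) :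
    ∫ x in Ω, |w x| ^ p = ∫ x, |Ω.indicator w x| ^ p := by
  rw [← integral_indicator hΩ.measurableSet]
  congr 1
  funext x
  by_cases hx : x ∈ Ω
  · simp [hx]
  · simp [hx, Real.zero_rpow (by linarith : p ≠ 0)]

/-- States with bounded sources have bounded energy. -/
lemma exists_energy_bound (hN : 0 < N) (hp : 1 < p) (hs : 0 < s) (hc₀ : 0 < c₀)
    (hδ : 0 < δ) (hk : IsKernel N p s c₀ δ k) (hΩ : IsOpen Ω) (hΩb : Bornology.IsBounded Ω)
    (hmin_pos : 0 < hmin) (hlt : hmin < hmax) (hh : MemH Ω δ hmin hmax h) {b : E → ℝ}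
    (hb : MemX Ω δ p k b) (hbu : EqOutside Ω δ b u₀) (R : ℝ) :
    ∃ M : ℝ, ∀ g u : E → ℝ, Admissible Ω δ p k h u₀ g u →
      ∫ x in Ω, |g x| ^ (p / (p - 1)) ≤ R →
      energy Ω δ p k h u ≤ M := by
  obtain ⟨C, hC0, hC⟩ := exists_poincare hN hp hs hc₀ hδ hk hΩ hΩb
  set c : ℝ := C * (2 / hmin * 2 ^ (p - 1))
  have hc : 0 ≤ c := by positivity
  -- Small enough that the energies coming from the source term enter with factor at most `1 / 2`.
  set η : ℝ := (1 / (2 * p * (c + 1))) ^ (p - 1)⁻¹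
  have hη : 0 < η := by positivity
  have hηc : p * (η ^ (p - 1) * c) ≤ 1 / 2 := by
    rw [← Real.rpow_mul (by positivity), inv_mul_cancel₀ (by linarith : p - 1 ≠ 0), Real.rpow_one,
      div_mul_eq_mul_div, one_mul, mul_div_assoc', div_le_div_iff₀ (by positivity) two_pos]
    nlinarith
  -- Solves `E(u) ≤ E(b) + p η⁻¹ R + (E(u) + E(b)) / 2` for `E(u)`.
  refine ⟨3 * energy Ω δ p k h b + 2 * (p * (η⁻¹ * R)), fun g u hgu hR => ?_⟩
  obtain ⟨hg, hu, huu, hst⟩ := hgu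
  have hub : EqOutside Ω δ u b := by
    filter_upwards [huu, hbu] with x hx hx'
    rw [hx, hx']
  have hw := MemX₀.of_sub hp hk hu hb hub
  set w : E → ℝ := fun x => u x - b x
  have hwL : MemLp w (ENNReal.ofReal p) (volume.restrict Ω) :=
    hw.1.1.mono_measure (Measure.restrict_mono (subset_extendedDomain Ω δ) le_rfl)
  -- Tangent inequality at `u` towards `b`; its linear term is the form tested with `b - u = -w`,
  -- which the state equation turns into `-∫ g w`.
  have h1 := integral_abs_rpow_add_signedPow_le hp
    (hu.memLp_increment hp hk hΩ hmin_pos hlt hh) (hb.memLp_increment hp hk hΩ hmin_pos hlt hh)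
  have h2 : ∫ z, signedPow p (u z.1 - u z.2) * ((b z.1 - b z.2) - (u z.1 - u z.2))
      ∂formMeasure Ω δ p k h = -∫ x in Ω, g x * w x := by
    rw [← hst w hw, weightedForm_eq hk hh.1 (hh.nonneg hΩ hmin_pos), ← integral_neg]
    congr 1
    funext z
    simp only [w]
    ring
  rw [h2] at h1
  have h3 := integral_mul_le_add hp hη hg hwL
  have h4 : ∫ x in Ω, |w x| ^ p ≤ c * (energy Ω δ p k h u + energy Ω δ p k h b) := by
    rw [setIntegral_abs_rpow_eq hΩ hp]
    refine (hC _ (hw.indicator hp hk hΩ) fun x hx => indicator_of_notMem hx _).trans ?_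
    rw [← energy_congr (ae_eq_indicator_of_eqOutside hΩ hw.2)]
    simp only [c]
    rw [mul_assoc, mul_assoc]
    refine mul_le_mul_of_nonneg_left ?_ hC0
    refine (energy_one_le hp hk hΩ hmin_pos hlt hh hw).trans ?_
    exact mul_le_mul_of_nonneg_left (energy_sub_le hp hk hΩ hmin_pos hlt hh hu hb) (by positivity)
  have hη1 : 0 ≤ η ^ (p - 1) := by positivity
  have h5 : p * ∫ x in Ω, g x * w x ≤ p * (η⁻¹ * R) + p * (η ^ (p - 1) * c) *
      (energy Ω δ p k h u + energy Ω δ p k h b) := by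
    have h6 : η⁻¹ * ∫ x in Ω, |g x| ^ (p / (p - 1)) ≤ η⁻¹ * R :=
      mul_le_mul_of_nonneg_left hR (by positivity)
    have h7 := mul_le_mul_of_nonneg_left h4 hη1
    have h8 : ∫ x in Ω, g x * w x ≤
        η⁻¹ * R + η ^ (p - 1) * (c * (energy Ω δ p k h u + energy Ω δ p k h b)) := by linarith
    have h9 := mul_le_mul_of_nonneg_left h8 (by linarith : 0 ≤ p)
    linarith
  have hu0 : 0 ≤ energy Ω δ p k h u := energy_nonneg _ _
  have hb0 : 0 ≤ energy Ω δ p k h b := energy_nonneg _ _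
  have h10 := mul_le_mul_of_nonneg_right hηc (add_nonneg hu0 hb0)
  have h11 : energy Ω δ p k h u + p * -∫ x in Ω, g x * w x ≤ energy Ω δ p k h b := h1
  linarith

/-- Comparison of the energies for two coefficients. -/
lemma energy_le_mul_energy_one (hp : 1 < p) (hk : IsKernel N p s c₀ δ k) (hΩ : IsOpen Ω)
    (hmin_pos : 0 < hmin) (hlt : hmin < hmax) (hh : MemH Ω δ hmin hmax h) {u : E → ℝ}
    (hu : MemX Ω δ p k u) :
    energy Ω δ p k h u ≤ hmax * energy Ω δ p k (fun _ => 1) u := by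
  have hi := integrable_abs_rpow hp ((memX_iff hp hk).1 hu).2
  have h1 := integral_mono_measure (formMeasure_le hk hΩ hmin_pos hlt hh)
    (Eventually.of_forall fun z => by simp only [Pi.zero_apply]; positivity)
    (hi.smul_measure ENNReal.ofReal_ne_top)
  rwa [integral_smul_measure, ENNReal.toReal_ofReal (hmin_pos.trans hlt).le] at h1

/-! ### Compactness of admissible pairs and the cost. -/

/-- Sequential compactness of sets of admissible pairs with bounded sources. -/
lemma exists_subseq_admissible (hN : 0 < N) (hp : 1 < p) (hs : 0 < s) (hc₀ : 0 < c₀)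
    (hδ : 0 < δ) (hk : IsKernel N p s c₀ δ k) (hΩ : IsOpen Ω) (hΩb : Bornology.IsBounded Ω)
    (hmin_pos : 0 < hmin) (hlt : hmin < hmax) (hh : MemH Ω δ hmin hmax h)
    (hh₀ : MemH Ω δ hmin hmax h₀) (hu₀ : ∃ w, MemX Ω δ p k w ∧ EqOutside Ω δ w u₀)
    {g u : ℕ → E → ℝ} (hgu : ∀ j, Admissible Ω δ p k h u₀ (g j) (u j)) {R : ℝ}
    (hR : ∀ j, ∫ x in Ω, |g j x| ^ (p / (p - 1)) ≤ R) :
    ∃ φ : ℕ → ℕ, StrictMono φ ∧ ∃ g' u' : E → ℝ, Admissible Ω δ p k h u₀ g' u' ∧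
      Tendsto (fun j => eLpNorm (u (φ j) - u') (ENNReal.ofReal p) (volume.restrict Ω))
        atTop (𝓝 0) ∧
      (∃ l, Tendsto (fun j => ∫ x in Ω, |g (φ j) x| ^ (p / (p - 1))) atTop (𝓝 l) ∧
        ∫ x in Ω, |g' x| ^ (p / (p - 1)) ≤ l) ∧
      ∃ l, Tendsto (fun j => energy Ω δ p k h₀ (u (φ j))) atTop (𝓝 l) ∧
        energy Ω δ p k h₀ u' ≤ l := by
  obtain ⟨b, hb, hbu⟩ := hu₀
  obtain ⟨M, hM⟩ := exists_energy_bound hN hp hs hc₀ hδ hk hΩ hΩb hmin_pos hlt hh hb hbu R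
  have huM : ∀ j, energy Ω δ p k h (u j) ≤ M := fun j => hM _ _ (hgu j) (hR j)
  have huX : ∀ j, MemX Ω δ p k (u j) := fun j => (hgu j).2.1
  have hw : ∀ j, MemX₀ Ω δ p k fun x => u j x - b x := fun j => by
    refine MemX₀.of_sub hp hk (huX j) hb ?_
    filter_upwards [(hgu j).2.2.1, hbu] with x hx hx'
    rw [hx, hx']
  set M₁ := 2 / hmin * (2 ^ (p - 1) * (M + energy Ω δ p k h b))
  have hwM : ∀ j, energy Ω δ p k (fun _ => 1) (fun x => u j x - b x) ≤ M₁ := fun j => by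
    refine (energy_one_le hp hk hΩ hmin_pos hlt hh (hw j)).trans ?_
    refine mul_le_mul_of_nonneg_left
      ((energy_sub_le hp hk hΩ hmin_pos hlt hh (huX j) hb).trans ?_) (by positivity)
    gcongr
    exact huM j
  set M₂ := 2 ^ (p - 1) * (hmax * M₁ + energy Ω δ p k h₀ b)
  have huM₂ : ∀ j, energy Ω δ p k h₀ (u j) ≤ M₂ := fun j => by
    have h1 := energy_add_le hp hk hΩ hmin_pos hlt hh₀ (hw j).1 hb
    simp only [sub_add_cancel] at h1
    refine h1.trans ?_
    have := (energy_le_mul_energy_one hp hk hΩ hmin_pos hlt hh₀ (hw j).1).trans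
      (mul_le_mul_of_nonneg_left (hwM j) (hmin_pos.trans hlt).le)
    exact mul_le_mul_of_nonneg_left (by linarith) (by positivity)
  obtain ⟨φ, hφ, v, hv, hvlim, hvae⟩ :=
    exists_subseq_tendsto_memX₀ hN hp hs hc₀ hδ hk hΩ hΩb hw hwM
  -- A further subsequence makes the source norms and the `h₀` energies converge:
  -- `exists_weak_limit` needs the former, and the limit of the cost needs both.
  obtain ⟨⟨l₁, l₂⟩, -, ψ, hψ, hl⟩ := (isCompact_Icc.prod isCompact_Icc).tendsto_subseq
    (s := Icc 0 R ×ˢ Icc 0 M₂)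
    (x := fun j => (∫ x in Ω, |g (φ j) x| ^ (p / (p - 1)), energy Ω δ p k h₀ (u (φ j))))
    fun j => ⟨⟨integral_nonneg fun x => by positivity, hR _⟩, energy_nonneg _ _, huM₂ _⟩
  have hl₁ : Tendsto (fun j => ∫ x in Ω, |g (φ (ψ j)) x| ^ (p / (p - 1))) atTop (𝓝 l₁) :=
    (continuous_fst.tendsto _).comp hl
  have hl₂ : Tendsto (fun j => energy Ω δ p k h₀ (u (φ (ψ j)))) atTop (𝓝 l₂) :=
    (continuous_snd.tendsto _).comp hl
  obtain ⟨g', hg', hg'l, hweak⟩ := exists_weak_limit (Real.HolderConjugate.conjExponent hp).symm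
    (fun j => g (φ (ψ j))) (fun j => (hgu _).1) l₁ hl₁
  set u' : E → ℝ := fun x => v x + b x
  have hu' : MemX Ω δ p k u' := hv.1.add hp hk hb
  have hae : ∀ᵐ x ∂volume.restrict (extendedDomain Ω δ),
      Tendsto (fun j => u (φ (ψ j)) x) atTop (𝓝 (u' x)) := by
    filter_upwards [hvae] with x hx
    have := (hx.comp hψ.tendsto_atTop).add_const (b x)
    simpa [Function.comp_def] using this
  have haeD : ∀ f : E → ℝ, ∀ᵐ z ∂formMeasure Ω δ p k f,
      Tendsto (fun j => u (φ (ψ j)) z.1 - u (φ (ψ j)) z.2) atTop (𝓝 (u' z.1 - u' z.2)) := by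
    intro f
    filter_upwards [ae_formMeasure_of_ae hae] with z hz
    exact hz.1.sub hz.2
  refine ⟨φ ∘ ψ, hφ.comp hψ, g', u', ⟨hg', hu', ?_, fun w hw' => ?_⟩, ?_, ⟨l₁, hl₁, hg'l⟩,
    l₂, hl₂, ?_⟩
  · filter_upwards [hbu, hv.2] with x hx hx'
    simp only [u']
    rw [hx, hx']; simp
  · have hwL : MemLp w (ENNReal.ofReal p) (volume.restrict Ω) :=
      hw'.1.1.mono_measure (Measure.restrict_mono (subset_extendedDomain Ω δ) le_rfl)
    refine (hweak w hwL _ ?_).symm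
    -- The left sides of the state equations converge, hence so do the source pairings, and the weak
    -- limit `g'` gives the limiting value.
    have h1 := tendsto_integral_signedPow_mul hp
      (fun j => (huX (φ (ψ j))).memLp_increment hp hk hΩ hmin_pos hlt hh)
      (hu'.memLp_increment hp hk hΩ hmin_pos hlt hh)
      (hw'.1.memLp_increment hp hk hΩ hmin_pos hlt hh) (fun j => huM (φ (ψ j))) (haeD h)
    rw [weightedForm_eq hk hh.1 (hh.nonneg hΩ hmin_pos)]
    refine h1.congr fun j => ?_
    rw [← (hgu (φ (ψ j))).2.2.2 w hw', weightedForm_eq hk hh.1 (hh.nonneg hΩ hmin_pos)]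
  · refine tendsto_of_tendsto_of_tendsto_of_le_of_le tendsto_const_nhds
      (hvlim.comp hψ.tendsto_atTop) (fun _ => zero_le) fun j => ?_
    have h1 : u ((φ ∘ ψ) j) - u' = (fun x => u (φ (ψ j)) x - b x) - v := by
      funext x
      simp only [u', Pi.sub_apply, Function.comp_apply]
      ring
    rw [h1]
    exact eLpNorm_mono_measure _ (Measure.restrict_mono (subset_extendedDomain Ω δ) le_rfl)
  · exact integral_le_of_tendsto_ae hp
      (fun j => (huX (φ (ψ j))).memLp_increment hp hk hΩ hmin_pos hlt hh₀) (haeD h₀) hl₂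

lemma cost_eq (hp : 1 < p) (hk : IsKernel N p s c₀ δ k) (hΩ : IsOpen Ω)
    (hmin_pos : 0 < hmin) (hh₀ : MemH Ω δ hmin hmax h₀) {β γ : ℝ} (hβ : 0 < β)
    {G : E → ℝ → ℝ} (hG : ∀ x ∈ Ω, ∀ a, 0 ≤ G x a) {g u : E → ℝ}
    (hg : MemLp g (ENNReal.ofReal (p / (p - 1))) (volume.restrict Ω)) :
    cost Ω δ p k G β γ h₀ g u = (∫⁻ x in Ω, ENNReal.ofReal (G x (u x))) +
      ENNReal.ofReal (β * ∫ x in Ω, |g x| ^ (p / (p - 1))) +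
      ENNReal.ofReal (γ * energy Ω δ p k h₀ u) := by
  have hi : Integrable (fun x => β * |g x| ^ (p / (p - 1))) (volume.restrict Ω) :=
    (integrable_abs_rpow (Real.HolderConjugate.conjExponent hp).symm.lt hg).const_mul β
  rw [cost, weightedForm_self hp hk hh₀.1 (hh₀.nonneg hΩ hmin_pos), ← integral_const_mul]
  rw [ofReal_integral_eq_lintegral_ofReal hi (Eventually.of_forall fun x => by
    simp only [Pi.zero_apply]; positivity), ← lintegral_add_right' _ hi.1.aemeasurable.ennreal_ofReal]
  congr 1
  refine setLIntegral_congr_fun hΩ.measurableSet fun x hx => ?_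
  exact ENNReal.ofReal_add (hG x hx _) (by positivity)

/-- Written additively in `[0, ∞]`, so the `G` integrals may be infinite and no subtraction is
needed. -/
lemma lintegral_ofReal_le_add {G : E → ℝ → ℝ} (hΩ : IsOpen Ω) {L : ℝ}
    (hL : ∀ x ∈ Ω, ∀ a b, |G x a - G x b| ≤ L * |a - b|) {u v : E → ℝ}
    (hu : AEStronglyMeasurable u (volume.restrict Ω))
    (hv : AEStronglyMeasurable v (volume.restrict Ω)) :
    ∫⁻ x in Ω, ENNReal.ofReal (G x (v x)) ≤ (∫⁻ x in Ω, ENNReal.ofReal (G x (u x))) +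
      ENNReal.ofReal |L| * eLpNorm (u - v) 1 (volume.restrict Ω) := by
  rw [eLpNorm_one_eq_lintegral_enorm, ← lintegral_const_mul' _ _ ENNReal.ofReal_ne_top,
    ← lintegral_add_right' _ ((hu.sub hv).enorm.const_mul _)]
  refine setLIntegral_mono' hΩ.measurableSet fun x hx => ?_
  rw [Real.enorm_eq_ofReal_abs, ← ENNReal.ofReal_mul (abs_nonneg L)]
  refine le_trans (ENNReal.ofReal_le_ofReal ?_) ENNReal.ofReal_add_le
  have h1 := hL x hx (u x) (v x)
  have h2 := neg_le_of_abs_le h1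
  have h3 : L * |u x - v x| ≤ |L| * |u x - v x| :=
    mul_le_mul_of_nonneg_right (le_abs_self L) (abs_nonneg _)
  simp only [Pi.sub_apply]
  linarith

end NonlocalControl

/-! ### The minimizing sequence and the passage to the limit. -/

open NonlocalControl

theorem mainTheorem4 {N : ℕ} (Ω : Set (EuclideanSpace ℝ (Fin N)))
    (hΩ_open : IsOpen Ω) (hΩ_bdd : Bornology.IsBounded Ω)
    (p s c₀ δ : ℝ) (hp : 1 < p) (hs : s ∈ Set.Ioo (0 : ℝ) 1) (hN : p * s < (N : ℝ))
    (hc₀ : 0 < c₀) (hδ : 0 < δ)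
    (k : ℝ → ℝ) (hk : NonlocalControl.IsKernel N p s c₀ δ k)
    (hmin hmax : ℝ) (hmin_pos : 0 < hmin) (hmin_lt : hmin < hmax)
    (h h₀ : EuclideanSpace ℝ (Fin N) → ℝ)
    (hh : NonlocalControl.MemH Ω δ hmin hmax h) (hh₀ : NonlocalControl.MemH Ω δ hmin hmax h₀)
    (u₀ : EuclideanSpace ℝ (Fin N) → ℝ)
    (hu₀ : ∃ w, NonlocalControl.MemX Ω δ p k w ∧ NonlocalControl.EqOutside Ω δ w u₀)
    (β γ : ℝ) (hβ : 0 < β) (hγ : 0 ≤ γ)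
    (G : EuclideanSpace ℝ (Fin N) → ℝ → ℝ)
    (hG_meas : AEMeasurable (Function.uncurry G)
      ((MeasureTheory.volume.restrict Ω).prod MeasureTheory.volume))
    (hG_nonneg : ∀ x ∈ Ω, ∀ a, 0 ≤ G x a)
    (L : ℝ) (hG_lip : ∀ x ∈ Ω, ∀ a b, |G x a - G x b| ≤ L * |a - b|) :
    ∃ g u : EuclideanSpace ℝ (Fin N) → ℝ,
      NonlocalControl.Admissible Ω δ p k h u₀ g u ∧
      ∀ f v : EuclideanSpace ℝ (Fin N) → ℝ, NonlocalControl.Admissible Ω δ p k h u₀ f v →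
        NonlocalControl.cost Ω δ p k G β γ h₀ g u ≤
          NonlocalControl.cost Ω δ p k G β γ h₀ f v := by
  have hs0 := hs.1
  have hN0 : 0 < N := by
    have : (0 : ℝ) < N := lt_trans (by positivity) hN
    exact_mod_cast this
  obtain ⟨u₁, hu₁⟩ := exists_isState_zero hN0 hp hs0 hc₀ hδ hk hΩ_open hΩ_bdd hmin_pos hmin_lt hh hu₀
  set S : Set ENNReal := {c | ∃ f v, Admissible Ω δ p k h u₀ f v ∧ c = cost Ω δ p k G β γ h₀ f v}
  have h0mem : Admissible Ω δ p k h u₀ 0 u₁ := ⟨MemLp.zero, hu₁⟩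
  have hle : ∀ f v, Admissible Ω δ p k h u₀ f v → sInf S ≤ cost Ω δ p k G β γ h₀ f v :=
    fun f v hfv => sInf_le ⟨f, v, hfv, rfl⟩
  suffices hex : ∃ g u, Admissible Ω δ p k h u₀ g u ∧ cost Ω δ p k G β γ h₀ g u ≤ sInf S by
    obtain ⟨g, u, hgu, hcost⟩ := hex
    exact ⟨g, u, hgu, fun f v hfv => hcost.trans (hle f v hfv)⟩
  -- If every admissible pair has infinite cost, any of them is optimal.
  rcases eq_or_ne (sInf S) ⊤ with htop | htop
  · exact ⟨0, u₁, h0mem, htop ▸ le_top⟩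
  obtain ⟨c, -, hclim, hcS⟩ := exists_seq_tendsto_sInf (S := S) ⟨_, 0, u₁, h0mem, rfl⟩
    (OrderBot.bddBelow S)
  -- Dropping the first `n₀` terms keeps all costs below `sInf S + 1`; dividing by `β` bounds the
  -- sources.
  obtain ⟨n₀, hn₀⟩ := eventually_atTop.1 (hclim.eventually_lt_const
    (ENNReal.lt_add_right htop one_ne_zero))
  choose g u hgu hcost using fun j => hcS (j + n₀)
  have hlim : Tendsto (fun j => cost Ω δ p k G β γ h₀ (g j) (u j)) atTop (𝓝 (sInf S)) :=
    (hclim.comp (tendsto_add_atTop_nat n₀)).congr hcost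
  have hcost_eq := fun f v (hfv : Admissible Ω δ p k h u₀ f v) =>
    cost_eq (γ := γ) (u := v) hp hk hΩ_open hmin_pos hh₀ hβ hG_nonneg hfv.1
  have hR : ∀ j, ∫ x in Ω, |g j x| ^ (p / (p - 1)) ≤ (sInf S + 1).toReal / β := by
    intro j
    rw [le_div_iff₀' hβ, ← ENNReal.ofReal_le_iff_le_toReal (by simpa using htop)]
    refine le_trans ?_ (hn₀ (j + n₀) (Nat.le_add_left _ _)).le
    rw [hcost j, hcost_eq _ _ (hgu j)]
    exact le_add_right le_add_self
  obtain ⟨φ, hφ, g', u', hgu', hu', ⟨l₁, hl₁, hg'⟩, l₂, hl₂, hu'₂⟩ := exists_subseq_admissible hN0 hp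
    hs0 hc₀ hδ hk hΩ_open hΩ_bdd hmin_pos hmin_lt hh hh₀ hu₀ hgu hR
  refine ⟨g', u', hgu', ?_⟩
  have hmeas : ∀ v, MemX Ω δ p k v → AEStronglyMeasurable v (volume.restrict Ω) := fun v hv =>
    hv.1.1.mono_measure (Measure.restrict_mono (subset_extendedDomain Ω δ) le_rfl)
  have hL1 : Tendsto (fun j => ENNReal.ofReal |L| * eLpNorm (u (φ j) - u') 1 (volume.restrict Ω))
      atTop (𝓝 0) := by
    have hfin : volume Ω ≠ ⊤ := hΩ_bdd.measure_lt_top.ne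
    -- The embedding constant of `L^p` in `L^1`, finite because `Ω` has finite measure.
    set K := (volume.restrict Ω) univ ^ (1 / (1 : ENNReal).toReal - 1 / (ENNReal.ofReal p).toReal)
    have hK : K ≠ ⊤ := by
      refine ENNReal.rpow_ne_top_of_nonneg ?_ (by simpa using hfin)
      rw [ENNReal.toReal_ofReal (by linarith), ENNReal.toReal_one, one_div_one, sub_nonneg,
        div_le_one (by linarith)]
      exact hp.le
    have h1 : Tendsto (fun j => ENNReal.ofReal |L| *
        (eLpNorm (u (φ j) - u') (ENNReal.ofReal p) (volume.restrict Ω) * K)) atTop (𝓝 0) := by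
      have := ENNReal.Tendsto.const_mul (a := ENNReal.ofReal |L|)
        (ENNReal.Tendsto.mul_const hu' (Or.inr hK)) (Or.inr ENNReal.ofReal_ne_top)
      simpa using this
    refine tendsto_of_tendsto_of_tendsto_of_le_of_le tendsto_const_nhds h1 (fun _ => zero_le)
      fun j => ?_
    exact mul_le_mul_right (eLpNorm_le_eLpNorm_mul_rpow_measure_univ (by simpa using hp.le)
      ((hmeas _ (hgu (φ j)).2.1).sub (hmeas _ hgu'.2.1))) _
  -- Only the state inside `G` is replaced by its limit, at the price of an error tending to zero;
  -- the other two terms keep the index and converge to `l₁` and `l₂` up to the factors `β` and `γ`.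
  have hkey : ∀ j, (∫⁻ x in Ω, ENNReal.ofReal (G x (u' x))) +
      ENNReal.ofReal (β * ∫ x in Ω, |g (φ j) x| ^ (p / (p - 1))) +
      ENNReal.ofReal (γ * energy Ω δ p k h₀ (u (φ j))) ≤
      cost Ω δ p k G β γ h₀ (g (φ j)) (u (φ j)) +
        ENNReal.ofReal |L| * eLpNorm (u (φ j) - u') 1 (volume.restrict Ω) := by
    intro j
    rw [hcost_eq _ _ (hgu (φ j)), add_right_comm _ _ (_ * _), add_right_comm _ _ (_ * _)]
    gcongr
    exact lintegral_ofReal_le_add hΩ_open hG_lip (hmeas _ (hgu (φ j)).2.1) (hmeas _ hgu'.2.1)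
  have hlim₁ := (tendsto_const_nhds (x := ∫⁻ x in Ω, ENNReal.ofReal (G x (u' x)))).add
    (ENNReal.tendsto_ofReal (hl₁.const_mul β)) |>.add (ENNReal.tendsto_ofReal (hl₂.const_mul γ))
  have hfinal := le_of_tendsto_of_tendsto' hlim₁ ((hlim.comp hφ.tendsto_atTop).add hL1) hkey
  rw [add_zero] at hfinal
  refine le_trans ?_ hfinal
  rw [hcost_eq _ _ hgu']
  gcongr
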